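/- **Model.** Fix a horizon $T$ and $n$ controllers. The state $X_t\in\mathbb R^{d_x}$ evolves as $X_{t+1}=A_tX_t+B_tU_t+W^0_t$, where $U_t=\mathrm{vec}(U^1_t,\dots,U^n_t)$ is the vector of control actions; controller $i$ observes $Y^i_t=C^i_tX_t+W^i_t$. The primitive random variables $X_1$, $W^0_t$, $W^i_t$ ($1\le t\le T$, $1\le i\le n$) are mutually independent, with $X_1\sim\mathcal N(0,\Sigma_x)$, $W^0_t\sim\mathcal N(0,\Sigma_{w^0})$, $W^i_t\sim\mathcal N(0,\Sigma_{w^i})$ (the covariance matrices may be singular). Put $Y_t=\mathrm{vec}(Y^1_t,\dots,Y^n_t)=C_tX_t+W^{1:n}_t$, and let $M_t=\mathrm{vec}(M^1_t,\dots,M^n_t)$ be the vector of local memories and $Z_t\in\mathbb R^{d_z}$ the increment of the shared memory; they satisfy $M_1=0$ and $$M_{t+1}=P_{mm,t}M_t+P_{my,t}Y_t+P_{mu,t}U_t,\qquad Z_t=P_{zm,t}M_t+P_{zy,t}Y_t+P_{zu,t}U_t,$$ with given matrices $P_{**,t}$ (generalized partial history sharing; partial history sharing is a special case). A *linear strategy*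 consists of matrices $K_t$, $G_t=\mathrm{diag}(G^1_t,\dots,G^n_t)$, $H_t=\mathrm{diag}(H^1_t,\dots,H^n_t)$ and uses $$U_t=\tilde U_t+G_tY_t+H_tM_t,\qquad \tilde U_t=K_tZ_{1:t-1}.$$ Problem (P1) is to minimize $\mathbb E\sum_{t=1}^T(X_t^{\mathsf T}QX_t+U_t^{\mathsf T}RU_t)$ over all linear strategies, where $Q$ is positive semidefinite and $R$ is positive definite. A minimizer is called a *best linear strategy*. **Matrices.** Given $(G_t,H_t)_t$, let $$\tilde A_t=\begin{bmatrix}A_t&B_tG_t&B_tH_t\\ C_{t+1}A_t&C_{t+1}B_tG_t&C_{t+1}B_tH_t\\0&P_{my,t}+P_{mu,t}G_t&P_{mm,t}+P_{mu,t}H_t\end{bmatrix},\quad \tilde B_t=\begin{bmatrix}B_t\\C_{t+1}B_t\\P_{mu,t}\end{bmatrix},\quad \tilde F_t=\begin{bmatrix}I&0\\C_{t+1}&I\\0&0\end{bmatrix},$$ $$\tilde C_t=\begin{bmatrix}0&P_{zy,t}+P_{zu,t}G_t&P_{zm,t}+P_{zu,t}H_t\end{bmatrix},\quad \tilde D_t=P_{zu,t},\quad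 \Sigma_w=\mathrm{diag}(\Sigma_{w^1},\dots,\Sigma_{w^n}),\quad \tilde\Sigma_t=\tilde F_t\,\mathrm{diag}(\Sigma_{w^0},\Sigma_w)\,\tilde F_t^{\mathsf T},$$ $$\tilde Q_t=\mathrm{diag}\left(Q,\begin{bmatrix}G_t^{\mathsf T}RG_t&G_t^{\mathsf T}RH_t\\H_t^{\mathsf T}RG_t&H_t^{\mathsf T}RH_t\end{bmatrix}\right),\quad \tilde N_t=\begin{bmatrix}0\\G_t^{\mathsf T}R\\H_t^{\mathsf T}R\end{bmatrix},\quad E_t=\begin{bmatrix}I&0\\C_t&0\\0&I\end{bmatrix},\quad \Pi=\begin{bmatrix}I&0&0\\0&0&I\end{bmatrix}.$$ With $V^{+}$ the Moore–Penrose inverse of $V$, let $\Gamma_t=\tilde P_t\tilde C_t^{\mathsf T}[\tilde C_t\tilde P_t\tilde C_t^{\mathsf T}]^{+}$, where $$\tilde P_1=\begin{bmatrix}\Sigma_x&\Sigma_xC_1^{\mathsf T}&0\\C_1\Sigma_x&C_1\Sigma_xC_1^{\mathsf T}+\Sigma_w&0\\0&0&0\end{bmatrix},\qquad \tilde P_{t+1}=\tilde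 A_t\tilde P_t\tilde A_t^{\mathsf T}+\tilde\Sigma_t-\tilde A_t\Gamma_t\tilde C_t\tilde P_t\tilde A_t^{\mathsf T}.$$ Let $S_{T+1}=0$ and, for $t=T,\dots,1$, with $\Lambda_t=\tilde N_t^{\mathsf T}+\tilde B_t^{\mathsf T}S_{t+1}\tilde A_t$, $$S_t=\tilde A_t^{\mathsf T}S_{t+1}\tilde A_t+\tilde Q_t-\Lambda_t^{\mathsf T}[R+\tilde B_t^{\mathsf T}S_{t+1}\tilde B_t]^{-1}\Lambda_t,\qquad \tilde K_t=-[R+\tilde B_t^{\mathsf T}S_{t+1}\tilde B_t]^{-1}\Lambda_t,\qquad \tilde L_t=\tilde K_tE_t,$$ $$J(G,H)=\sum_{t=1}^{T}\mathrm{tr}\big[\tilde P_t\tilde Q_t+(\tilde\Sigma_t+\tilde A_t\tilde P_t\tilde A_t^{\mathsf T}-\tilde P_{t+1})S_{t+1}\big]$$ (the matrices with index $T+1$ other than $S_{T+1}$ are irrelevant, as they are multiplied by $S_{T+1}=0$). **Theorem.** For a linear strategy, let $\breve X_t=\mathbb E[\mathrm{vec}(X_t,Y_t,M_t)\mid Z_{1:t-1},\tilde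 U_{1:t-1}]$ and $\breve S_t=\mathbb E[\mathrm{vec}(X_t,M_t)\mid Z_{1:t-1},\tilde U_{1:t-1}]$. All equalities between random variables hold almost surely. 1. Under every linear strategy the total cost and the components of $\mathrm{vec}(X_t,Y_t,M_t)$ are integrable, and $\breve X_t=E_t\breve S_t$ for $1\le t\le T$; the estimate $\breve S_t$ satisfies $\breve S_1=0$ and, for $1\le t<T$, $$\breve S_{t+1}=\Pi\Big[\tilde A_tE_t\breve S_t+\tilde B_t\tilde U_t+\tilde A_t\Gamma_t\big(Z_t-\tilde C_tE_t\breve S_t-\tilde D_t\tilde U_t\big)\Big];$$ and the conditional covariance of $\mathrm{vec}(X_t,Y_t,M_t)-\breve X_t$ given $(Z_{1:t-1},\tilde U_{1:t-1})$ is the deterministic matrix $\tilde P_t$. 2. For arbitrary fixed $(G_t,H_t)_t$, best gains $(K_t)_t$ exist. Gains $(K_t)_t$ are best if and only if the resulting control satisfies $U_t=\tilde L_t\breve S_t+G_tY_t+H_tM_t$ for $1\le t\le T$, and then the cost is $J(G,H)$. 3. In Problem (P1), every best linear strategy is of the form $$U_t=\tilde L_t\breve S_t+G_tY_t+H_tM_t,\qquad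 1\le t\le T.$$ More precisely, a linear strategy is best if and only if its control is of this form and its $(G_t,H_t)_t$ minimizes $J$. -/

import Mathlib

open MeasureTheory ProbabilityTheory Matrix

noncomputable section

namespace PHS

/-! Time is indexed from `0`: the index `t` with `t < T` is time `t + 1` when counting from `1`, and the
shared memory available at time `t` is `(Z s)` for `s < t`. Families of data are indexed by `ℕ`,
but only indices inside the horizon are ever relevant. -/

/-! ### Pseudo-inverse of a symmetric matrix -/

section Pinv

variable {ι : Type} [Fintype ι] [DecidableEq ι]

/-- The Moore-Penrose inverse of a real symmetric matrix `V`: in an orthonormal eigenbasis every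
nonzero eigenvalue is inverted and the eigenvalue zero is kept. -/
def pinv (V : Matrix ι ι ℝ) : Matrix ι ι ℝ := cfc (fun x : ℝ => x⁻¹) V

theorem pinv_spec {V : Matrix ι ι ℝ} (hV : V.IsHermitian) :
    V * pinv V * V = V ∧ pinv V * V * pinv V = pinv V ∧
      (V * pinv V).IsHermitian ∧ (pinv V * V).IsHermitian := by
  have hsa : IsSelfAdjoint V := hV
  have hc (f : ℝ → ℝ) : ContinuousOn f (spectrum ℝ V) :=
    (Matrix.finite_real_spectrum (A := V)).continuousOn f
  have hid : cfc (fun x : ℝ => x) V = V := cfc_id' ℝ V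
  have h1 : V * pinv V = cfc (fun x : ℝ => x * x⁻¹) V := by
    rw [cfc_mul (fun x : ℝ => x) (fun x : ℝ => x⁻¹) V (hc _) (hc _), hid, pinv]
  have h2 : pinv V * V = cfc (fun x : ℝ => x⁻¹ * x) V := by
    rw [cfc_mul (fun x : ℝ => x⁻¹) (fun x : ℝ => x) V (hc _) (hc _), hid, pinv]
  refine ⟨?_, ?_, ?_, ?_⟩
  · calc V * pinv V * V = cfc (fun x : ℝ => x * x⁻¹ * x) V := by
          rw [cfc_mul (fun x : ℝ => x * x⁻¹) (fun x : ℝ => x) V (hc _) (hc _), hid, h1]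
      _ = cfc (fun x : ℝ => x) V := by simp only [mul_inv_mul_cancel]
      _ = V := hid
  · calc pinv V * V * pinv V = cfc (fun x : ℝ => x⁻¹ * x * x⁻¹) V := by
          rw [cfc_mul (fun x : ℝ => x⁻¹ * x) (fun x : ℝ => x⁻¹) V (hc _) (hc _), h2, pinv]
      _ = cfc (fun x : ℝ => x⁻¹) V := by
          congr 1; funext x
          by_cases hx : x = 0 <;> simp [hx]
      _ = pinv V := rfl
  · rw [h1]; exact cfc_predicate (p := IsSelfAdjoint) _ V
  · rw [h2]; exact cfc_predicate (p := IsSelfAdjoint) _ V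

theorem pinv_eq_inv {V : Matrix ι ι ℝ} (hV : V.IsHermitian) (hu : IsUnit V.det) :
    pinv V = V⁻¹ := by
  have h := (pinv_spec hV).1
  have h' : V * pinv V = 1 := by
    have := congrArg (fun N => N * V⁻¹) h
    simpa [Matrix.mul_assoc, Matrix.mul_nonsing_inv V hu] using this
  exact (Matrix.inv_eq_right_inv h').symm

end Pinv

/-! ### The decentralized LQG model -/

/-- Index set of the stacked vector `vec(V^1, ..., V^n)` with `V^i` of dimension `d i`. -/
abbrev Stk {n : ℕ} (d : Fin n → ℕ) : Type := Σ i : Fin n, Fin (d i)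

/-- Data of the decentralized LQG problem with (generalized) partial history sharing:
horizon, dimensions, system and observation matrices, cost matrices, noise covariances, and the
matrices of the update rules of the local memories and of the shared memory. -/
structure Model where
  T : ℕ
  n : ℕ
  dx : ℕ
  dz : ℕ
  dy : Fin n → ℕ
  du : Fin n → ℕ
  dm : Fin n → ℕ
  A : ℕ → Matrix (Fin dx) (Fin dx) ℝ
  B : ℕ → Matrix (Fin dx) (Stk du) ℝ
  Cloc : ℕ → (i : Fin n) → Matrix (Fin (dy i)) (Fin dx) ℝ
  Q : Matrix (Fin dx) (Fin dx) ℝ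
  R : Matrix (Stk du) (Stk du) ℝ
  covX : Matrix (Fin dx) (Fin dx) ℝ
  covW0 : Matrix (Fin dx) (Fin dx) ℝ
  covW : (i : Fin n) → Matrix (Fin (dy i)) (Fin (dy i)) ℝ
  Pmm : ℕ → Matrix (Stk dm) (Stk dm) ℝ
  Pmy : ℕ → Matrix (Stk dm) (Stk dy) ℝ
  Pmu : ℕ → Matrix (Stk dm) (Stk du) ℝ
  Pzm : ℕ → Matrix (Fin dz) (Stk dm) ℝ
  Pzy : ℕ → Matrix (Fin dz) (Stk dy) ℝ
  Pzu : ℕ → Matrix (Fin dz) (Stk du) ℝ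
  Q_posSemidef : Q.PosSemidef
  R_posDef : R.PosDef
  covX_posSemidef : covX.PosSemidef
  covW0_posSemidef : covW0.PosSemidef
  covW_posSemidef : ∀ i, (covW i).PosSemidef

namespace Model

variable (S : Model)

/-- Index set of the state `X`. -/
abbrev IX : Type := Fin S.dx
/-- Index set of the stacked observation `Y`. -/
abbrev IY : Type := Stk S.dy
/-- Index set of the stacked control `U`. -/
abbrev IU : Type := Stk S.du
/-- Index set of the stacked local memory `M`. -/
abbrev IM : Type := Stk S.dm
/-- Index set of the increment `Z` of the shared memory. -/
abbrev IZ : Type := Fin S.dz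
/-- Index set of `vec(X, Y, M)`. -/
abbrev IXYM : Type := S.IX ⊕ (S.IY ⊕ S.IM)
/-- Index set of `vec(X, M)`. -/
abbrev IXM : Type := S.IX ⊕ S.IM

/-- The stacked observation matrix `C_t`. -/
def C (t : ℕ) : Matrix S.IY S.IX ℝ := Matrix.of fun p j => S.Cloc t p.1 p.2 j

/-- The gains `G^i_t`, `H^i_t` that act on the local data `Y^i_t`, `M^i_t`. -/
structure LocalGains where
  Gloc : ℕ → (i : Fin S.n) → Matrix (Fin (S.du i)) (Fin (S.dy i)) ℝ
  Hloc : ℕ → (i : Fin S.n) → Matrix (Fin (S.du i)) (Fin (S.dm i)) ℝ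

/-- The gains `K^i_t` that act on the shared memory `vec(Z_s : s < t)`. -/
def SharedGains : Type :=
  (t : ℕ) → (i : Fin S.n) → Matrix (Fin (S.du i)) (Fin t × S.IZ) ℝ

/-- The primitive random variables, as functions on the sample space. -/
structure Primitives (Ω : Type*) where
  X0 : Ω → S.IX → ℝ
  W0 : ℕ → Ω → S.IX → ℝ
  W : ℕ → (i : Fin S.n) → Ω → Fin (S.dy i) → ℝ

variable {S}

/-- `G_t = diag(G^1_t, ..., G^n_t)`. -/
def LocalGains.G (g : S.LocalGains) (t : ℕ) : Matrix S.IU S.IY ℝ := blockDiagonal' (g.Gloc t)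

/-- `H_t = diag(H^1_t, ..., H^n_t)`. -/
def LocalGains.H (g : S.LocalGains) (t : ℕ) : Matrix S.IU S.IM ℝ := blockDiagonal' (g.Hloc t)

/-- The stacked gain `K_t`. -/
def SharedGains.mat (K : S.SharedGains) (t : ℕ) : Matrix S.IU (Fin t × S.IZ) ℝ :=
  Matrix.of fun p j => K t p.1 p.2 j

/-- The σ-algebras generated by the primitive random variables: the initial state (`none`), the
process noise `W^0_t` (`some (t, none)`), the observation noise `W^i_t` (`some (t, some i)`). -/
abbrev Primitives.sigma {Ω : Type*} (ξ : S.Primitives Ω) :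
    Option (Fin S.T × Option (Fin S.n)) → MeasurableSpace Ω
  | none => MeasurableSpace.comap ξ.X0 inferInstance
  | some (t, none) => MeasurableSpace.comap (ξ.W0 t) inferInstance
  | some (t, some i) => MeasurableSpace.comap (ξ.W t i) inferInstance

/-- The primitive random variables are mutually independent centred Gaussian vectors with the
covariances prescribed by the model. -/
structure Primitives.IsGaussianIndep {Ω : Type*} [MeasurableSpace Ω] (ξ : S.Primitives Ω)
    (μ : Measure Ω) : Prop where
  measurable_X0 : Measurable ξ.X0
  measurable_W0 : ∀ t < S.T, Measurable (ξ.W0 t)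
  measurable_W : ∀ t < S.T, ∀ i, Measurable (ξ.W t i)
  law_X0 : μ.map (fun ω => WithLp.toLp 2 (ξ.X0 ω)) = multivariateGaussian 0 S.covX
  law_W0 : ∀ t < S.T,
    μ.map (fun ω => WithLp.toLp 2 (ξ.W0 t ω)) = multivariateGaussian 0 S.covW0
  law_W : ∀ t < S.T, ∀ i,
    μ.map (fun ω => WithLp.toLp 2 (ξ.W t i ω)) = multivariateGaussian 0 (S.covW i)
  indep : iIndep ξ.sigma μ

/-! ### The closed-loop processes of a linear strategy -/

section ClosedLoop

variable {Ω : Type*} (K : S.SharedGains) (g : S.LocalGains) (ξ : S.Primitives Ω)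

/-- The stacked observation `Y_t` as a function of the state. -/
def obs (t : ℕ) (ω : Ω) (x : S.IX → ℝ) : S.IY → ℝ :=
  S.C t *ᵥ x + fun p => ξ.W t p.1 ω p.2

/-- The shared-memory part `K_t Z_{<t}` of the control; `h s` holds the increment `Z_s`. -/
def sharedCtrl (t : ℕ) (h : ℕ → S.IZ → ℝ) : S.IU → ℝ :=
  K.mat t *ᵥ fun p => h p.1 p.2

/-- The state, the local memory, and the record of the increments of the shared memory, at
time `t`, when the linear strategy `(K, g)` is used. -/
def traj (ω : Ω) : ℕ → (S.IX → ℝ) × (S.IM → ℝ) × (ℕ → S.IZ → ℝ)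
  | 0 => (ξ.X0 ω, 0, 0)
  | t + 1 =>
    let x := (traj ω t).1
    let m := (traj ω t).2.1
    let h := (traj ω t).2.2
    let y := obs ξ t ω x
    let u := sharedCtrl K t h + g.G t *ᵥ y + g.H t *ᵥ m
    (S.A t *ᵥ x + S.B t *ᵥ u + ξ.W0 t ω,
      S.Pmm t *ᵥ m + S.Pmy t *ᵥ y + S.Pmu t *ᵥ u,
      Function.update h t (S.Pzm t *ᵥ m + S.Pzy t *ᵥ y + S.Pzu t *ᵥ u))

/-- The state `X_t`. -/
def X (t : ℕ) (ω : Ω) : S.IX → ℝ := (traj K g ξ ω t).1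

/-- The local memories `M_t`. -/
def M (t : ℕ) (ω : Ω) : S.IM → ℝ := (traj K g ξ ω t).2.1

/-- The observations `Y_t = C_t X_t + W^{1:n}_t`. -/
def Y (t : ℕ) (ω : Ω) : S.IY → ℝ := obs ξ t ω (X K g ξ t ω)

/-- The coordinator's part `Ũ_t = K_t Z_{<t}` of the control. -/
def Ut (t : ℕ) (ω : Ω) : S.IU → ℝ := sharedCtrl K t (traj K g ξ ω t).2.2

/-- The control `U_t = Ũ_t + G_t Y_t + H_t M_t`. -/
def U (t : ℕ) (ω : Ω) : S.IU → ℝ :=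
  Ut K g ξ t ω + g.G t *ᵥ Y K g ξ t ω + g.H t *ᵥ M K g ξ t ω

/-- The increment `Z_t` of the shared memory. -/
def Z (t : ℕ) (ω : Ω) : S.IZ → ℝ :=
  S.Pzm t *ᵥ M K g ξ t ω + S.Pzy t *ᵥ Y K g ξ t ω + S.Pzu t *ᵥ U K g ξ t ω

theorem traj_record {s t : ℕ} (h : s < t) (ω : Ω) :
    (traj K g ξ ω t).2.2 s = Z K g ξ s ω := by
  induction t with
  | zero => exact absurd h (Nat.not_lt_zero s)
  | succ t ih =>
    rcases Nat.lt_succ_iff_lt_or_eq.1 h with h' | rfl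
    · rw [← ih h']
      simp [traj, Function.update_of_ne h'.ne]
    · simp only [traj, Function.update_self]
      rfl

theorem Ut_eq (t : ℕ) (ω : Ω) :
    Ut K g ξ t ω = K.mat t *ᵥ fun p : Fin t × S.IZ => Z K g ξ p.1 ω p.2 := by
  unfold Ut sharedCtrl
  congr 1
  funext p
  rw [traj_record K g ξ p.1.2 ω]

theorem X_succ (t : ℕ) (ω : Ω) :
    X K g ξ (t + 1) ω = S.A t *ᵥ X K g ξ t ω + S.B t *ᵥ U K g ξ t ω + ξ.W0 t ω := rfl

theorem M_succ (t : ℕ) (ω : Ω) :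
    M K g ξ (t + 1) ω = S.Pmm t *ᵥ M K g ξ t ω + S.Pmy t *ᵥ Y K g ξ t ω
      + S.Pmu t *ᵥ U K g ξ t ω := rfl

/-- `vec(X_t, Y_t, M_t)`. -/
def XYM (t : ℕ) (ω : Ω) : S.IXYM → ℝ :=
  Sum.elim (X K g ξ t ω) (Sum.elim (Y K g ξ t ω) (M K g ξ t ω))

/-- `vec(X_t, M_t)`. -/
def XM (t : ℕ) (ω : Ω) : S.IXM → ℝ := Sum.elim (X K g ξ t ω) (M K g ξ t ω)

/-- The σ-algebra generated by `Z_s` and `Ũ_s`, `s < t`. -/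
abbrev common (t : ℕ) : MeasurableSpace Ω :=
  ⨆ s : Fin t, MeasurableSpace.comap (Z K g ξ s) inferInstance ⊔
    MeasurableSpace.comap (Ut K g ξ s) inferInstance

/-- The total cost `∑_t (X_tᵀ Q X_t + U_tᵀ R U_t)`. -/
def totalCost (ω : Ω) : ℝ :=
  ∑ t ∈ Finset.range S.T,
    (X K g ξ t ω ⬝ᵥ S.Q *ᵥ X K g ξ t ω + U K g ξ t ω ⬝ᵥ S.R *ᵥ U K g ξ t ω)

variable [MeasurableSpace Ω] (μ : Measure Ω)

/-- The estimate of `vec(X_t, Y_t, M_t)` given the common information (conditional expectation,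
componentwise). -/
def estXYM (t : ℕ) (ω : Ω) : S.IXYM → ℝ :=
  fun a => (μ[fun ω' => XYM K g ξ t ω' a | common K g ξ t]) ω

/-- The estimate of `vec(X_t, M_t)` given the common information (conditional expectation,
componentwise). -/
def estXM (t : ℕ) (ω : Ω) : S.IXM → ℝ :=
  fun a => (μ[fun ω' => XM K g ξ t ω' a | common K g ξ t]) ω

/-- The expected total cost. -/
def cost : ℝ := ∫ ω, totalCost K g ξ ω ∂μ

/-- The linear strategy `(K, g)` is a best linear strategy. -/
def IsBestLinear : Prop :=
  ∀ (K' : S.SharedGains) (g' : S.LocalGains), cost K g ξ μ ≤ cost K' g' ξ μ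

/-- For the fixed local gains `g`, the shared-memory gains `K` are best. -/
def IsBestShared : Prop := ∀ K' : S.SharedGains, cost K g ξ μ ≤ cost K' g ξ μ

end ClosedLoop

/-! ### The matrices of the coordinated system -/

section Matrices

variable (S)

/-- The block matrix `[I 0; C_t 0; 0 I]`. -/
def lift (t : ℕ) : Matrix S.IXYM S.IXM ℝ :=
  fromRows (fromCols 1 0) (fromRows (fromCols (S.C t) 0) (fromCols 0 1))

/-- The block matrix `[I 0 0; 0 0 I]`. -/
def proj : Matrix S.IXM S.IXYM ℝ :=
  fromRows (fromCols 1 (fromCols 0 0)) (fromCols 0 (fromCols 0 1))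

/-- `B̃_t = [B_t; C_{t+1} B_t; P_{mu,t}]`. -/
def Bt (t : ℕ) : Matrix S.IXYM S.IU ℝ :=
  fromRows (S.B t) (fromRows (S.C (t + 1) * S.B t) (S.Pmu t))

/-- `F̃_t = [I 0; C_{t+1} I; 0 0]`, acting on `vec(W^0_t, W^{1:n}_{t+1})`. -/
def Ft (t : ℕ) : Matrix S.IXYM (S.IX ⊕ S.IY) ℝ :=
  fromRows (fromCols 1 0) (fromRows (fromCols (S.C (t + 1)) 1) (fromCols 0 0))

/-- Covariance of `W^{1:n}_t`. -/
def covWs : Matrix S.IY S.IY ℝ := blockDiagonal' S.covW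

/-- Covariance of `F̃_t vec(W^0_t, W^{1:n}_{t+1})`. -/
def covNoise (t : ℕ) : Matrix S.IXYM S.IXYM ℝ :=
  Ft S t * fromBlocks S.covW0 0 0 (covWs S) * (Ft S t)ᵀ

/-- `D̃` in `Z_t = C̃ vec(X_t, Y_t, M_t) + D̃ Ũ_t`. -/
def Dt (t : ℕ) : Matrix S.IZ S.IU ℝ := S.Pzu t

variable {S} (g : S.LocalGains)

/-- `Ã_t`. -/
def At (t : ℕ) : Matrix S.IXYM S.IXYM ℝ :=
  fromRows
    (fromCols (S.A t) (fromCols (S.B t * g.G t) (S.B t * g.H t)))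
    (fromRows
      (fromCols (S.C (t + 1) * S.A t)
        (fromCols (S.C (t + 1) * S.B t * g.G t) (S.C (t + 1) * S.B t * g.H t)))
      (fromCols 0
        (fromCols (S.Pmy t + S.Pmu t * g.G t) (S.Pmm t + S.Pmu t * g.H t))))

/-- `C̃` in `Z_t = C̃ vec(X_t, Y_t, M_t) + D̃ Ũ_t`. -/
def Ct (t : ℕ) : Matrix S.IZ S.IXYM ℝ :=
  fromCols 0 (fromCols (S.Pzy t + S.Pzu t * g.G t) (S.Pzm t + S.Pzu t * g.H t))

/-- `Q̃_t`. -/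
def Qt (t : ℕ) : Matrix S.IXYM S.IXYM ℝ :=
  fromBlocks S.Q 0 0
    (fromBlocks ((g.G t)ᵀ * S.R * g.G t) ((g.G t)ᵀ * S.R * g.H t)
      ((g.H t)ᵀ * S.R * g.G t) ((g.H t)ᵀ * S.R * g.H t))

/-- `Ñ_t = [0; G_tᵀ R; H_tᵀ R]`. -/
def Nt (t : ℕ) : Matrix S.IXYM S.IU ℝ :=
  fromRows 0 (fromRows ((g.G t)ᵀ * S.R) ((g.H t)ᵀ * S.R))

/-- `P̃ C̃ᵀ [C̃ P̃ C̃ᵀ]⁺`, with `C̃` the matrix of the observation `Z_t`. -/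
def gainOf (P : Matrix S.IXYM S.IXYM ℝ) (t : ℕ) : Matrix S.IXYM S.IZ ℝ :=
  P * (Ct g t)ᵀ * pinv (Ct g t * P * (Ct g t)ᵀ)

/-- The error covariances `P̃_t`, through the forward Riccati equation. -/
def Pt : ℕ → Matrix S.IXYM S.IXYM ℝ
  | 0 => fromBlocks S.covX (fromCols (S.covX * (S.C 0)ᵀ) 0) (fromRows (S.C 0 * S.covX) 0)
      (fromBlocks (S.C 0 * S.covX * (S.C 0)ᵀ + covWs S) 0 0 0)
  | t + 1 => At g t * Pt t * (At g t)ᵀ + covNoise S t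
      - At g t * gainOf g (Pt t) t * Ct g t * Pt t * (At g t)ᵀ

/-- `Λ_t = Ñ_tᵀ + B̃_tᵀ S Ã_t`, where `S` is the value matrix of the next time. -/
def Lam (V : Matrix S.IXYM S.IXYM ℝ) (t : ℕ) : Matrix S.IU S.IXYM ℝ :=
  (Nt g t)ᵀ + (Bt S t)ᵀ * V * At g t

/-- One step of the backward Riccati equation, from the value matrix `V` of the next time. -/
def riccatiStep (V : Matrix S.IXYM S.IXYM ℝ) (t : ℕ) : Matrix S.IXYM S.IXYM ℝ :=
  (At g t)ᵀ * V * At g t + Qt g t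
    - (Lam g V t)ᵀ * (S.R + (Bt S t)ᵀ * V * Bt S t)⁻¹ * Lam g V t

/-- The value matrix at time `t` with `k` steps to go. -/
def valueToGo : ℕ → ℕ → Matrix S.IXYM S.IXYM ℝ
  | 0, _ => 0
  | k + 1, t => riccatiStep g (valueToGo k (t + 1)) t

/-- The value matrices `S_t` of the backward Riccati equation, with `S_T = 0` after the last
step. -/
def St (t : ℕ) : Matrix S.IXYM S.IXYM ℝ := valueToGo g (S.T - t) t

/-- The terminal condition and the backward recursion of the value matrices. -/
theorem St_spec : St g S.T = 0 ∧ ∀ t < S.T, St g t = riccatiStep g (St g (t + 1)) t := by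
  refine ⟨by simp [St, valueToGo], fun t ht => ?_⟩
  have h : S.T - t = (S.T - (t + 1)) + 1 := by omega
  simp only [St]
  rw [h]
  rfl

/-- The gains `K̃_t = -[R + B̃_tᵀ S_{t+1} B̃_t]⁻¹ Λ_t`. -/
def Kt (t : ℕ) : Matrix S.IU S.IXYM ℝ :=
  -((S.R + (Bt S t)ᵀ * St g (t + 1) * Bt S t)⁻¹ * Lam g (St g (t + 1)) t)

/-- The gains `L̃_t = K̃_t [I 0; C_t 0; 0 I]`. -/
def Lt (t : ℕ) : Matrix S.IU S.IXM ℝ := Kt g t * lift S t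

/-- The performance `J = ∑_t tr[P̃_t Q̃_t + (Σ̃_t + Ã_t P̃_t Ã_tᵀ - P̃_{t+1}) S_{t+1}]`. -/
def perf : ℝ :=
  ∑ t ∈ Finset.range S.T,
    (Pt g t * Qt g t
      + (covNoise S t + At g t * Pt g t * (At g t)ᵀ - Pt g (t + 1)) * St g (t + 1)).trace

/-- The right-hand side of the update of the estimate of `vec(X_t, M_t)`, from its present value
`s`, the coordinator's control `u` and the new increment `z` of the shared memory. -/
def update (t : ℕ) (s : S.IXM → ℝ) (u : S.IU → ℝ) (z : S.IZ → ℝ) : S.IXM → ℝ :=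
  proj S *ᵥ (At g t *ᵥ (lift S t *ᵥ s) + Bt S t *ᵥ u
    + At g t *ᵥ (gainOf g (Pt g t) t *ᵥ (z - Ct g t *ᵥ (lift S t *ᵥ s) - Dt S t *ᵥ u)))

end Matrices

end Model

end PHS

end

noncomputable section

namespace PHS

section SecondMoment

variable {Ω : Type*} {ι κ l : Type*}

/-- All components of the random vector `f` lie in the space `V` of random variables. -/
def VecMem (V : Submodule ℝ (Ω → ℝ)) (f : Ω → ι → ℝ) : Prop :=
  ∀ a, (fun ω => f ω a) ∈ V

namespace VecMem

variable {V V' : Submodule ℝ (Ω → ℝ)} {f g : Ω → ι → ℝ}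

theorem mono (hf : VecMem V f) (h : V ≤ V') : VecMem V' f := fun a => h (hf a)

theorem zero : VecMem V (fun _ => (0 : ι → ℝ)) := fun _ => V.zero_mem

theorem add (hf : VecMem V f) (hg : VecMem V g) : VecMem V (fun ω => f ω + g ω) :=
  fun a => V.add_mem (hf a) (hg a)

theorem sub (hf : VecMem V f) (hg : VecMem V g) : VecMem V (fun ω => f ω - g ω) :=
  fun a => V.sub_mem (hf a) (hg a)

theorem mulVec [Fintype ι] (A : Matrix κ ι ℝ) (hf : VecMem V f) :
    VecMem V (fun ω => A *ᵥ f ω) := by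
  intro a
  have : (fun ω => (A *ᵥ f ω) a) = ∑ i, A a i • fun ω => f ω i := by
    funext ω
    simp [Matrix.mulVec, dotProduct]
  rw [this]
  exact V.sum_mem fun i _ => V.smul_mem _ (hf i)

theorem sumElim {g : Ω → κ → ℝ} (hf : VecMem V f) (hg : VecMem V g) :
    VecMem V (fun ω => Sum.elim (f ω) (g ω)) := by
  rintro (a | a)
  · exact hf a
  · exact hg a

end VecMem

variable [MeasurableSpace Ω] (μ : Measure Ω)

/-- The matrix of mixed second moments of two random vectors. -/
def mom (f : Ω → ι → ℝ) (g : Ω → κ → ℝ) : Matrix ι κ ℝ :=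
  Matrix.of fun a b => ∫ ω, f ω a * g ω b ∂μ

/-- All members of the space `V` of random variables are square integrable. -/
def SqInt (V : Submodule ℝ (Ω → ℝ)) : Prop := ∀ f ∈ V, MemLp f 2 μ

variable {μ} {V : Submodule ℝ (Ω → ℝ)}

theorem SqInt.integrable_mul (hV : SqInt μ V) {f g : Ω → ℝ} (hf : f ∈ V) (hg : g ∈ V) :
    Integrable (fun ω => f ω * g ω) μ :=
  (hV f hf).integrable_mul (hV g hg)

theorem mom_transpose (f : Ω → ι → ℝ) (g : Ω → κ → ℝ) : (mom μ f g)ᵀ = mom μ g f := by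
  ext a b
  simp [mom, mul_comm]

theorem mom_add_left (hV : SqInt μ V) {f f' : Ω → ι → ℝ} {g : Ω → κ → ℝ}
    (hf : VecMem V f) (hf' : VecMem V f') (hg : VecMem V g) :
    mom μ (fun ω => f ω + f' ω) g = mom μ f g + mom μ f' g := by
  ext a b
  simp only [mom, Matrix.of_apply, Matrix.add_apply, Pi.add_apply, add_mul]
  exact integral_add (hV.integrable_mul (hf a) (hg b)) (hV.integrable_mul (hf' a) (hg b))

theorem mom_mulVec_left [Fintype ι] (hV : SqInt μ V) (A : Matrix l ι ℝ) {f : Ω → ι → ℝ}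
    {g : Ω → κ → ℝ} (hf : VecMem V f) (hg : VecMem V g) :
    mom μ (fun ω => A *ᵥ f ω) g = A * mom μ f g := by
  ext a b
  simp only [mom, Matrix.of_apply, Matrix.mul_apply, Matrix.mulVec, dotProduct, Finset.sum_mul]
  rw [integral_finsetSum _ fun i _ => ?_]
  · simp only [mul_assoc, integral_const_mul]
  · simp only [mul_assoc]
    exact (hV.integrable_mul (hf i) (hg b)).const_mul _

theorem mom_add_right (hV : SqInt μ V) {f : Ω → ι → ℝ} {g g' : Ω → κ → ℝ}
    (hf : VecMem V f) (hg : VecMem V g) (hg' : VecMem V g') :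
    mom μ f (fun ω => g ω + g' ω) = mom μ f g + mom μ f g' := by
  rw [← mom_transpose, mom_add_left hV hg hg' hf, transpose_add, mom_transpose, mom_transpose]

theorem mom_mulVec_right [Fintype κ] (hV : SqInt μ V) (A : Matrix l κ ℝ) {f : Ω → ι → ℝ}
    {g : Ω → κ → ℝ} (hf : VecMem V f) (hg : VecMem V g) :
    mom μ f (fun ω => A *ᵥ g ω) = mom μ f g * Aᵀ := by
  rw [← mom_transpose, mom_mulVec_left hV A hg hf, transpose_mul, mom_transpose]

/-- Orthogonality, in the sense of second moments, to each member of a space of random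
variables. -/
def Orth (μ : Measure Ω) (f : Ω → ι → ℝ) (H : Submodule ℝ (Ω → ℝ)) : Prop :=
  ∀ a, ∀ h ∈ H, ∫ ω, f ω a * h ω ∂μ = 0

theorem Orth.mom_eq_zero {f : Ω → ι → ℝ} {g : Ω → κ → ℝ} {H : Submodule ℝ (Ω → ℝ)}
    (h : Orth μ f H) (hg : VecMem H g) : mom μ f g = 0 := by
  ext a b
  exact h a _ (hg b)

theorem Orth.mom_eq_zero' {f : Ω → ι → ℝ} {g : Ω → κ → ℝ} {H : Submodule ℝ (Ω → ℝ)}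
    (h : Orth μ f H) (hg : VecMem H g) : mom μ g f = 0 := by
  rw [← mom_transpose, h.mom_eq_zero hg, transpose_zero]

theorem Orth.of_span (hV : SqInt μ V) {f : Ω → ι → ℝ} (hf : VecMem V f) {s : Set (Ω → ℝ)}
    (hs : s ⊆ V) (h : ∀ a, ∀ g ∈ s, ∫ ω, f ω a * g ω ∂μ = 0) :
    Orth μ f (Submodule.span ℝ s) := by
  intro a g hg
  have hle : Submodule.span ℝ s ≤ V := Submodule.span_le.2 hs
  induction hg using Submodule.span_induction with
  | mem x hx => exact h a x hx
  | zero => simp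
  | add x y hx hy ihx ihy =>
    simp only [Pi.add_apply, mul_add]
    rw [integral_add (hV.integrable_mul (hf a) (hle hx)) (hV.integrable_mul (hf a) (hle hy)),
      ihx, ihy, add_zero]
  | smul c x hx ih =>
    simp only [Pi.smul_apply, smul_eq_mul, mul_left_comm _ c]
    rw [integral_const_mul, ih, mul_zero]

theorem posSemidef_mom [Fintype ι] (hV : SqInt μ V) {f : Ω → ι → ℝ} (hf : VecMem V f) :
    (mom μ f f).PosSemidef := by
  refine PosSemidef.of_dotProduct_mulVec_nonneg ?_ fun x => ?_
  · rw [IsHermitian, conjTranspose_eq_transpose_of_trivial, mom_transpose]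
  · have h := mom_mulVec_right hV (Matrix.of fun (_ : Unit) i => x i)
      (hf.mulVec (Matrix.of fun (_ : Unit) i => x i)) hf
    rw [mom_mulVec_left hV _ hf hf] at h
    have h' := congrFun (congrFun h ()) ()
    have e : star x ⬝ᵥ mom μ f f *ᵥ x = ((Matrix.of fun (_ : Unit) i => x i) * mom μ f f *
        (Matrix.of fun (_ : Unit) i => x i)ᵀ) () () := by
      rw [Matrix.mul_assoc]
      simp [Matrix.mul_apply, Matrix.mulVec, dotProduct]
    rw [e, ← h']
    simp only [mom, Matrix.of_apply]
    exact integral_nonneg fun ω => mul_self_nonneg _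

theorem integrable_dotProduct_mulVec [Fintype ι] [Fintype κ] (hV : SqInt μ V)
    (A : Matrix ι κ ℝ) {f : Ω → ι → ℝ} {g : Ω → κ → ℝ} (hf : VecMem V f) (hg : VecMem V g) :
    Integrable (fun ω => f ω ⬝ᵥ A *ᵥ g ω) μ := by
  simp only [dotProduct]
  exact integrable_finsetSum _ fun i _ => hV.integrable_mul (hf i) (hg.mulVec A i)

theorem integral_dotProduct_mulVec [Fintype ι] [Fintype κ] (hV : SqInt μ V)
    (A : Matrix ι κ ℝ) {f : Ω → ι → ℝ} {g : Ω → κ → ℝ} (hf : VecMem V f) (hg : VecMem V g) :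
    ∫ ω, f ω ⬝ᵥ A *ᵥ g ω ∂μ = (A * mom μ g f).trace := by
  rw [← mom_mulVec_left hV A hg hf]
  simp only [dotProduct, Matrix.trace, Matrix.diag, mom, Matrix.of_apply]
  rw [integral_finsetSum _ fun i _ => hV.integrable_mul (hf i) (hg.mulVec A i)]
  simp only [mul_comm]

end SecondMoment

section GaussianSpan

variable {Ω : Type*} [MeasurableSpace Ω] {μ : Measure Ω} {ι κ l : Type*}

theorem hasGaussianLaw_of_mem_span [Fintype ι] [Fintype κ] [Fintype l] {b : ι → Ω → ℝ}
    (hb : HasGaussianLaw (fun ω i => b i ω) μ)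
    {f : κ → Ω → ℝ} {g : l → Ω → ℝ} (hf : ∀ k, f k ∈ Submodule.span ℝ (Set.range b))
    (hg : ∀ k, g k ∈ Submodule.span ℝ (Set.range b)) :
    HasGaussianLaw (fun ω => ((fun k => f k ω), fun k => g k ω)) μ := by
  simp only [Submodule.mem_span_range_iff_exists_fun] at hf hg
  choose c hc using hf
  choose d hd using hg
  let Φ : (ι → ℝ) →ₗ[ℝ] (κ → ℝ) × (l → ℝ) :=
    (Matrix.mulVecLin (Matrix.of c)).prod (Matrix.mulVecLin (Matrix.of d))
  have e : (fun ω => ((fun k => f k ω), fun k => g k ω)) =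
      fun ω => LinearMap.toContinuousLinearMap Φ (fun i => b i ω) := by
    funext ω
    refine Prod.ext ?_ ?_ <;> funext k
    · simp [Φ, ← hc, Matrix.mulVec, dotProduct]
    · simp [Φ, ← hd, Matrix.mulVec, dotProduct]
  rw [e]
  exact hb.map_fun _

theorem indepFun_of_mom_eq_zero [Fintype ι] [Fintype κ] [Fintype l] {b : ι → Ω → ℝ}
    (hb : HasGaussianLaw (fun ω i => b i ω) μ) (h0 : ∀ i, ∫ ω, b i ω ∂μ = 0)
    {f : Ω → κ → ℝ} {g : Ω → l → ℝ} (hf : VecMem (Submodule.span ℝ (Set.range b)) f)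
    (hg : VecMem (Submodule.span ℝ (Set.range b)) g) (h : mom μ f g = 0) :
    IndepFun f g μ := by
  have := hb.isProbabilityMeasure
  have hG := hasGaussianLaw_of_mem_span hb hf hg
  refine hG.indepFun_of_covariance_eval (X := fun i ω => f ω i) (Y := fun i ω => g ω i)
    fun i j => ?_
  rw [covariance_eq_sub (hG.fst.eval i).memLp_two (hG.snd.eval j).memLp_two]
  have h1 : ∫ ω, f ω i ∂μ = 0 := by
    obtain ⟨c, hc⟩ := (Submodule.mem_span_range_iff_exists_fun ℝ).1 (hf i)
    have e : ∀ ω, f ω i = ∑ k, c k * b k ω := fun ω => by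
      simpa using (congrFun hc ω).symm
    simp only [e]
    rw [integral_finsetSum _ fun i _ => ((hb.eval i).integrable.const_mul _)]
    simp [integral_const_mul, h0]
  have h2 : ∫ ω, f ω i * g ω j ∂μ = 0 := congrFun (congrFun h i) j
  simp [h1, h2]

end GaussianSpan

namespace Model

section Primitive

variable {S : Model} {Ω : Type*}

variable (S) in
/-- The names of the primitive random vectors. -/
abbrev PIdx : Type := Option (Fin S.T × Option (Fin S.n))

/-- The dimension of a primitive random vector. -/
abbrev PIdx.dim : S.PIdx → ℕ
  | none => S.dx
  | some (_, none) => S.dx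
  | some (_, some i) => S.dy i

/-- A primitive random vector. -/
def Primitives.vec (ξ : S.Primitives Ω) : (p : S.PIdx) → Ω → Fin (PIdx.dim p) → ℝ
  | none => ξ.X0
  | some (t, none) => ξ.W0 t
  | some (t, some i) => ξ.W t i

/-- The covariance of a primitive random vector. -/
def PIdx.cov : (p : S.PIdx) → Matrix (Fin (PIdx.dim p)) (Fin (PIdx.dim p)) ℝ
  | none => S.covX
  | some (_, none) => S.covW0
  | some (_, some i) => S.covW i

/-- The time from which on a primitive random vector enters `vec(X_t, Y_t, M_t)`. -/
def PIdx.time : S.PIdx → ℕ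
  | none => 0
  | some (t, none) => t + 1
  | some (t, some _) => t

/-- The components of all primitive random vectors. -/
def Primitives.comp (ξ : S.Primitives Ω) (q : Σ p : S.PIdx, Fin (PIdx.dim p)) (ω : Ω) : ℝ :=
  ξ.vec q.1 ω q.2

/-- The span of the components of all primitive random vectors. -/
def Primitives.total (ξ : S.Primitives Ω) : Submodule ℝ (Ω → ℝ) :=
  Submodule.span ℝ (Set.range ξ.comp)

/-- The span of the components of the primitive random vectors up to time `t`. -/
def Primitives.space (ξ : S.Primitives Ω) (t : ℕ) : Submodule ℝ (Ω → ℝ) :=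
  Submodule.span ℝ (ξ.comp '' {q | PIdx.time q.1 ≤ t})

/-- The stacked observation noise. -/
def Primitives.Ws (ξ : S.Primitives Ω) (t : ℕ) (ω : Ω) : S.IY → ℝ := fun p => ξ.W t p.1 ω p.2

namespace Primitives

variable (ξ : S.Primitives Ω)

theorem space_mono {s t : ℕ} (h : s ≤ t) : ξ.space s ≤ ξ.space t :=
  Submodule.span_mono (Set.image_mono fun _ hq => le_trans hq h)

theorem space_le_total (t : ℕ) : ξ.space t ≤ ξ.total :=
  Submodule.span_mono (Set.image_subset_range _ _)

theorem vecMem_vec {p : S.PIdx} {t : ℕ} (h : PIdx.time p ≤ t) : VecMem (ξ.space t) (ξ.vec p) :=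
  fun a => Submodule.subset_span ⟨⟨p, a⟩, h, rfl⟩

theorem vecMem_X0 : VecMem (ξ.space 0) ξ.X0 := ξ.vecMem_vec (p := none) le_rfl

theorem vecMem_W0 {t : ℕ} (h : t < S.T) : VecMem (ξ.space (t + 1)) (ξ.W0 t) :=
  ξ.vecMem_vec (p := some (⟨t, h⟩, none)) le_rfl

theorem vecMem_Ws {t : ℕ} (h : t < S.T) : VecMem (ξ.space t) (ξ.Ws t) :=
  fun a => ξ.vecMem_vec (p := some (⟨t, h⟩, some a.1)) le_rfl a.2

end Primitives

theorem PIdx.posSemidef_cov (p : S.PIdx) : p.cov.PosSemidef := by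
  rcases p with _ | ⟨t, _ | i⟩
  · exact S.covX_posSemidef
  · exact S.covW0_posSemidef
  · exact S.covW_posSemidef i

namespace Primitives.IsGaussianIndep

variable [MeasurableSpace Ω] {μ : Measure Ω} {ξ : S.Primitives Ω}

theorem measurable_vec (hξ : ξ.IsGaussianIndep μ) (p : S.PIdx) : Measurable (ξ.vec p) := by
  rcases p with _ | ⟨t, _ | i⟩
  · exact hξ.measurable_X0
  · exact hξ.measurable_W0 t t.2
  · exact hξ.measurable_W t t.2 i

theorem law_vec (hξ : ξ.IsGaussianIndep μ) (p : S.PIdx) :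
    μ.map (fun ω => WithLp.toLp 2 (ξ.vec p ω)) = multivariateGaussian 0 p.cov := by
  rcases p with _ | ⟨t, _ | i⟩
  · exact hξ.law_X0
  · exact hξ.law_W0 t t.2
  · exact hξ.law_W t t.2 i

theorem iIndepFun_vec (hξ : ξ.IsGaussianIndep μ) : iIndepFun ξ.vec μ := by
  rw [iIndepFun_iff_iIndep]
  convert hξ.indep using 1
  funext p
  rcases p with _ | ⟨t, _ | i⟩ <;> rfl

theorem hasLaw_vec (hξ : ξ.IsGaussianIndep μ) (p : S.PIdx) :
    HasLaw (fun ω => WithLp.toLp 2 (ξ.vec p ω)) (multivariateGaussian 0 p.cov) μ :=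
  ⟨((WithLp.measurable_toLp 2 _).comp (hξ.measurable_vec p)).aemeasurable, hξ.law_vec p⟩

theorem hasGaussianLaw_vec (hξ : ξ.IsGaussianIndep μ) (p : S.PIdx) :
    HasGaussianLaw (ξ.vec p) μ :=
  (hξ.hasLaw_vec p).hasGaussianLaw.map_equiv_fun (PiLp.continuousLinearEquiv 2 ℝ (fun _ => ℝ))

theorem hasGaussianLaw_comp (hξ : ξ.IsGaussianIndep μ) :
    HasGaussianLaw (fun ω q => ξ.comp q ω) μ :=
  (hξ.iIndepFun_vec.hasGaussianLaw hξ.hasGaussianLaw_vec).map_fun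
    (ContinuousLinearMap.pi fun q : Σ p : S.PIdx, Fin p.dim =>
      (ContinuousLinearMap.proj (R := ℝ) (φ := fun _ : Fin q.1.dim => ℝ) q.2).comp
        (ContinuousLinearMap.proj (R := ℝ) (φ := fun p : S.PIdx => Fin p.dim → ℝ) q.1))

theorem integral_vec (hξ : ξ.IsGaussianIndep μ) (p : S.PIdx) (a : Fin p.dim) :
    ∫ ω, ξ.vec p ω a ∂μ = 0 := by
  have h := (hξ.hasLaw_vec p).integral_comp (f := fun x : EuclideanSpace ℝ (Fin p.dim) => x a)
    (by fun_prop)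
  have h0 := ContinuousLinearMap.integral_comp_id_comm (μ := multivariateGaussian 0 p.cov)
    IsGaussian.integrable_id (EuclideanSpace.proj (𝕜 := ℝ) a)
  simp only [integral_id_multivariateGaussian, map_zero] at h0
  exact h.trans h0

theorem integral_comp (hξ : ξ.IsGaussianIndep μ) (q : Σ p : S.PIdx, Fin p.dim) :
    ∫ ω, ξ.comp q ω ∂μ = 0 :=
  hξ.integral_vec q.1 q.2

theorem mom_vec (hξ : ξ.IsGaussianIndep μ) (p : S.PIdx) :
    mom μ (ξ.vec p) (ξ.vec p) = p.cov := by
  ext a b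
  have := (hξ.hasGaussianLaw_vec p).isProbabilityMeasure
  have h := (hξ.hasLaw_vec p).covariance_comp
    (f := fun x : EuclideanSpace ℝ (Fin p.dim) => x a)
    (g := fun x : EuclideanSpace ℝ (Fin p.dim) => x b) (by fun_prop) (by fun_prop)
  rw [covariance_eval_multivariateGaussian p.posSemidef_cov] at h
  rw [← h]
  refine Eq.symm ((covariance_eq_sub ((hξ.hasGaussianLaw_vec p).eval a).memLp_two
    ((hξ.hasGaussianLaw_vec p).eval b).memLp_two).trans ?_)
  rw [hξ.integral_vec, zero_mul, sub_zero]
  rfl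

theorem mom_vec_of_ne (hξ : ξ.IsGaussianIndep μ) {p q : S.PIdx} (hpq : p ≠ q) :
    mom μ (ξ.vec p) (ξ.vec q) = 0 := by
  ext a b
  have h : IndepFun (fun ω => ξ.vec p ω a) (fun ω => ξ.vec q ω b) μ :=
    (hξ.iIndepFun_vec.indepFun hpq).comp (measurable_pi_apply a) (measurable_pi_apply b)
  have h2 := h.integral_mul_eq_mul_integral
    ((hξ.hasGaussianLaw_vec p).eval a).aemeasurable.aestronglyMeasurable
    ((hξ.hasGaussianLaw_vec q).eval b).aemeasurable.aestronglyMeasurable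
  rw [hξ.integral_vec, zero_mul] at h2
  exact h2

theorem measurable_comp (hξ : ξ.IsGaussianIndep μ) (q : Σ p : S.PIdx, Fin p.dim) :
    Measurable (ξ.comp q) :=
  (measurable_pi_apply q.2).comp (hξ.measurable_vec q.1)

theorem measurable_of_mem_total (hξ : ξ.IsGaussianIndep μ) {f : Ω → ℝ} (hf : f ∈ ξ.total) :
    Measurable f := by
  induction hf using Submodule.span_induction with
  | mem x hx => obtain ⟨q, rfl⟩ := hx; exact hξ.measurable_comp q
  | zero => exact measurable_const
  | add x y _ _ hx hy => exact hx.add hy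
  | smul c x _ hx => exact hx.const_smul c

theorem sqInt_total (hξ : ξ.IsGaussianIndep μ) : SqInt μ ξ.total := by
  intro f hf
  induction hf using Submodule.span_induction with
  | mem x hx => obtain ⟨q, rfl⟩ := hx; exact (hξ.hasGaussianLaw_comp.eval q).memLp_two
  | zero => exact MemLp.zero
  | add x y _ _ hx hy => exact hx.add hy
  | smul c x _ hx => exact hx.const_smul c

theorem orth_vec (hξ : ξ.IsGaussianIndep μ) {p : S.PIdx} {t : ℕ} (h : t < p.time) :
    Orth μ (ξ.vec p) (ξ.space t) := by
  refine Orth.of_span hξ.sqInt_total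
    ((ξ.vecMem_vec le_rfl).mono (ξ.space_le_total p.time)) ?_ ?_
  · rintro _ ⟨q, -, rfl⟩
    exact Submodule.subset_span ⟨q, rfl⟩
  · rintro a _ ⟨q, hq, rfl⟩
    have hne : p ≠ q.1 := by
      rintro rfl
      exact absurd hq (not_le.2 h)
    exact congrFun (congrFun (hξ.mom_vec_of_ne hne) a) q.2

theorem orth_W0 (hξ : ξ.IsGaussianIndep μ) {t : ℕ} (h : t < S.T) :
    Orth μ (ξ.W0 t) (ξ.space t) :=
  hξ.orth_vec (p := some (⟨t, h⟩, none)) (Nat.lt_succ_self t)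

theorem orth_Ws (hξ : ξ.IsGaussianIndep μ) {s t : ℕ} (hst : s < t) (h : t < S.T) :
    Orth μ (ξ.Ws t) (ξ.space s) :=
  fun a => hξ.orth_vec (p := some (⟨t, h⟩, some a.1)) hst a.2

theorem mom_X0 (hξ : ξ.IsGaussianIndep μ) : mom μ ξ.X0 ξ.X0 = S.covX := hξ.mom_vec none

theorem mom_W0 (hξ : ξ.IsGaussianIndep μ) {t : ℕ} (h : t < S.T) :
    mom μ (ξ.W0 t) (ξ.W0 t) = S.covW0 := hξ.mom_vec (some (⟨t, h⟩, none))

theorem mom_Ws (hξ : ξ.IsGaussianIndep μ) {t : ℕ} (h : t < S.T) :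
    mom μ (ξ.Ws t) (ξ.Ws t) = covWs S := by
  ext ⟨i, a⟩ ⟨j, b⟩
  rcases eq_or_ne i j with rfl | hij
  · rw [covWs, blockDiagonal'_apply_eq]
    exact congrFun (congrFun (hξ.mom_vec (some (⟨t, h⟩, some i))) a) b
  · rw [covWs, blockDiagonal'_apply_ne _ _ _ hij]
    have hne : (some (⟨t, h⟩, some i) : S.PIdx) ≠ some (⟨t, h⟩, some j) := by simpa using hij
    exact congrFun (congrFun (hξ.mom_vec_of_ne hne) a) b

theorem mom_X0_Ws (hξ : ξ.IsGaussianIndep μ) {t : ℕ} (h : t < S.T) :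
    mom μ ξ.X0 (ξ.Ws t) = 0 := by
  ext a b
  have hne : (none : S.PIdx) ≠ some (⟨t, h⟩, some b.1) := by simp
  exact congrFun (congrFun (hξ.mom_vec_of_ne hne) a) b.2

theorem mom_W0_Ws (hξ : ξ.IsGaussianIndep μ) {s t : ℕ} (hs : s < S.T) (ht : t < S.T) :
    mom μ (ξ.W0 s) (ξ.Ws t) = 0 := by
  ext a b
  have hne : (some (⟨s, hs⟩, none) : S.PIdx) ≠ some (⟨t, ht⟩, some b.1) := by simp
  exact congrFun (congrFun (hξ.mom_vec_of_ne hne) a) b.2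

end Primitives.IsGaussianIndep

end Primitive

end Model

open scoped MatrixOrder in
theorem mul_pinv_mul_cancel {ι κ : Type} [Fintype ι] [DecidableEq ι] [Fintype κ] [DecidableEq κ]
    {P : Matrix ι ι ℝ} (hP : P.PosSemidef) (C : Matrix κ ι ℝ) :
    P * Cᵀ * pinv (C * P * Cᵀ) * (C * P * Cᵀ) = P * Cᵀ := by
  obtain ⟨B, rfl⟩ : ∃ B : Matrix ι ι ℝ, P = Bᵀ * B := by
    obtain ⟨B, hB⟩ := CStarAlgebra.nonneg_iff_eq_star_mul_self.1 (Matrix.nonneg_iff_posSemidef.2 hP)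
    rw [star_eq_conjTranspose] at hB
    exact ⟨B, by rw [hB, conjTranspose_eq_transpose_of_trivial]⟩
  set V := C * (Bᵀ * B) * Cᵀ with hV
  have hVD : V = (B * Cᵀ)ᵀ * (B * Cᵀ) := by
    simp only [hV, transpose_mul, transpose_transpose, Matrix.mul_assoc]
  have hH : V.IsHermitian := by
    rw [IsHermitian, conjTranspose_eq_transpose_of_trivial, hVD]
    simp [transpose_mul]
  have h1 : V * (1 - pinv V * V) = 0 := by
    rw [Matrix.mul_sub, ← Matrix.mul_assoc, (pinv_spec hH).1, Matrix.mul_one, sub_self]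
  have h2 : (B * Cᵀ) * (1 - pinv V * V) = 0 := by
    rw [← conjTranspose_mul_self_eq_zero, conjTranspose_eq_transpose_of_trivial, transpose_mul,
      Matrix.mul_assoc, ← Matrix.mul_assoc (B * Cᵀ)ᵀ, ← hVD, h1, Matrix.mul_zero]
  have h3 : Bᵀ * ((B * Cᵀ) * (1 - pinv V * V)) = 0 := by rw [h2, Matrix.mul_zero]
  rw [Matrix.mul_sub, Matrix.mul_sub, sub_eq_zero, Matrix.mul_one] at h3
  simp only [Matrix.mul_assoc] at h3 ⊢
  exact h3.symm

namespace Model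

variable {S : Model}

theorem gainOf_mul (g : S.LocalGains) {P : Matrix S.IXYM S.IXYM ℝ} (hP : P.PosSemidef) (t : ℕ) :
    gainOf g P t * (Ct g t * P * (Ct g t)ᵀ) = P * (Ct g t)ᵀ :=
  mul_pinv_mul_cancel hP (Ct g t)

theorem lift_mul_proj_mul_At (g : S.LocalGains) (t : ℕ) :
    lift S (t + 1) * (proj S * At g t) = At g t := by
  simp only [lift, proj, At, fromRows_mul, fromCols_mul_fromRows, Matrix.one_mul, Matrix.zero_mul,
    add_zero, zero_add]
  simp only [mul_fromCols, Matrix.mul_assoc]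

theorem lift_mul_proj_mul_Bt (t : ℕ) : lift S (t + 1) * (proj S * Bt S t) = Bt S t := by
  simp only [lift, proj, Bt, fromRows_mul, fromCols_mul_fromRows, Matrix.one_mul, Matrix.zero_mul,
    add_zero, zero_add]

/-- `[0 G_t H_t]`, so that `U_t = Ũ_t + [0 G_t H_t] vec(X_t, Y_t, M_t)`. -/
def LocalGains.loc (g : S.LocalGains) (t : ℕ) : Matrix S.IU S.IXYM ℝ :=
  fromCols 0 (fromCols (g.G t) (g.H t))

theorem Nt_eq (g : S.LocalGains) (t : ℕ) : Nt g t = (g.loc t)ᵀ * S.R := by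
  simp only [Nt, LocalGains.loc, transpose_fromCols, fromRows_mul, transpose_zero, Matrix.zero_mul]

theorem Qt_eq (g : S.LocalGains) (t : ℕ) :
    Qt g t = fromBlocks S.Q 0 0 0 + (g.loc t)ᵀ * S.R * g.loc t := by
  simp only [Qt, LocalGains.loc, transpose_fromCols, fromRows_mul, transpose_zero, Matrix.zero_mul,
    mul_fromCols, Matrix.mul_zero]
  ext (a | a | a) (b | b | b) <;> simp

section Processes

variable {Ω : Type*} (K : S.SharedGains) (g : S.LocalGains) (ξ : S.Primitives Ω)

theorem Y_eq (t : ℕ) (ω : Ω) : Y K g ξ t ω = S.C t *ᵥ X K g ξ t ω + ξ.Ws t ω := rfl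

theorem U_eq (t : ℕ) (ω : Ω) : U K g ξ t ω = Ut K g ξ t ω + g.loc t *ᵥ XYM K g ξ t ω := by
  simp only [U, LocalGains.loc, XYM, fromCols_mulVec_sumElim, Matrix.zero_mulVec, zero_add,
    add_assoc]

theorem XYM_zero (ω : Ω) :
    XYM K g ξ 0 ω = fromRows 1 (fromRows (S.C 0) 0) *ᵥ ξ.X0 ω
      + fromRows 0 (fromRows 1 0) *ᵥ ξ.Ws 0 ω := by
  simp only [fromRows_mulVec, Matrix.one_mulVec, Matrix.zero_mulVec, ← Sum.elim_add_add, add_zero]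
  rfl

theorem XYM_succ (t : ℕ) (ω : Ω) :
    XYM K g ξ (t + 1) ω = At g t *ᵥ XYM K g ξ t ω + Bt S t *ᵥ Ut K g ξ t ω
      + Ft S t *ᵥ Sum.elim (ξ.W0 t ω) (ξ.Ws (t + 1) ω) := by
  rw [XYM, Y_eq, X_succ, M_succ, U]
  simp only [At, Bt, Ft, XYM, fromRows_mulVec, fromCols_mulVec_sumElim, Matrix.one_mulVec,
    Matrix.zero_mulVec, ← Sum.elim_add_add, add_zero, zero_add, Matrix.mulVec_add,
    Matrix.add_mulVec, Matrix.mulVec_mulVec, Matrix.mul_assoc]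
  congr 1
  · abel
  · congr 1
    · abel
    · abel

theorem Z_eq (t : ℕ) (ω : Ω) :
    Z K g ξ t ω = Ct g t *ᵥ XYM K g ξ t ω + Dt S t *ᵥ Ut K g ξ t ω := by
  rw [Z, U]
  simp only [Ct, Dt, XYM, fromCols_mulVec_sumElim, Matrix.zero_mulVec, zero_add,
    Matrix.mulVec_add, Matrix.add_mulVec, Matrix.mulVec_mulVec]
  abel

/-- The filter that the update rule of the estimate of `vec(X_t, M_t)` defines. -/
def filt : ℕ → Ω → S.IXM → ℝ
  | 0, _ => 0
  | t + 1, ω => update g t (filt t ω) (Ut K g ξ t ω) (Z K g ξ t ω)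

/-- The estimate of `vec(X_t, Y_t, M_t)` that the filter produces. -/
def filtXYM (t : ℕ) (ω : Ω) : S.IXYM → ℝ := lift S t *ᵥ filt K g ξ t ω

/-- The error of the filter. -/
def err (t : ℕ) (ω : Ω) : S.IXYM → ℝ := XYM K g ξ t ω - filtXYM K g ξ t ω

theorem filtXYM_zero (ω : Ω) : filtXYM K g ξ 0 ω = 0 := by
  simp [filtXYM, filt]

theorem XYM_eq_filtXYM_add_err (t : ℕ) (ω : Ω) :
    XYM K g ξ t ω = filtXYM K g ξ t ω + err K g ξ t ω := by
  rw [err, add_sub_cancel]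

theorem innovation_eq (t : ℕ) (ω : Ω) :
    Z K g ξ t ω - Ct g t *ᵥ filtXYM K g ξ t ω - Dt S t *ᵥ Ut K g ξ t ω
      = Ct g t *ᵥ err K g ξ t ω := by
  rw [Z_eq, err, Matrix.mulVec_sub]
  abel

theorem filtXYM_succ (t : ℕ) (ω : Ω) :
    filtXYM K g ξ (t + 1) ω = At g t *ᵥ filtXYM K g ξ t ω + Bt S t *ᵥ Ut K g ξ t ω
      + (At g t * gainOf g (Pt g t) t * Ct g t) *ᵥ err K g ξ t ω := by
  have h : filtXYM K g ξ (t + 1) ω = lift S (t + 1) *ᵥ (proj S *ᵥ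
      (At g t *ᵥ filtXYM K g ξ t ω + Bt S t *ᵥ Ut K g ξ t ω + At g t *ᵥ (gainOf g (Pt g t) t *ᵥ
        (Z K g ξ t ω - Ct g t *ᵥ filtXYM K g ξ t ω - Dt S t *ᵥ Ut K g ξ t ω)))) := rfl
  rw [h, innovation_eq]
  simp only [Matrix.mulVec_add, Matrix.mulVec_mulVec]
  simp only [← Matrix.mul_assoc]
  simp only [Matrix.mul_assoc (lift S (t + 1)), lift_mul_proj_mul_At, lift_mul_proj_mul_Bt]

theorem err_succ (t : ℕ) (ω : Ω) :
    err K g ξ (t + 1) ω = (At g t - At g t * gainOf g (Pt g t) t * Ct g t) *ᵥ err K g ξ t ω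
      + Ft S t *ᵥ Sum.elim (ξ.W0 t ω) (ξ.Ws (t + 1) ω) := by
  conv_lhs => rw [err, XYM_succ, filtXYM_succ, XYM_eq_filtXYM_add_err]
  rw [Matrix.mulVec_add, Matrix.sub_mulVec]
  abel

/-- The span of the components of `Z_s`, `s < t`. -/
def hist (t : ℕ) : Submodule ℝ (Ω → ℝ) :=
  Submodule.span ℝ {f | ∃ s < t, ∃ a, f = fun ω => Z K g ξ s ω a}

theorem hist_mono {s t : ℕ} (h : s ≤ t) : hist K g ξ s ≤ hist K g ξ t :=
  Submodule.span_mono fun _ ⟨r, hr, hf⟩ => ⟨r, hr.trans_le h, hf⟩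

theorem vecMem_hist_Z {s t : ℕ} (h : s < t) : VecMem (hist K g ξ t) (Z K g ξ s) :=
  fun a => Submodule.subset_span ⟨s, h, a, rfl⟩

theorem vecMem_hist_Ut (t : ℕ) : VecMem (hist K g ξ t) (Ut K g ξ t) := by
  have h : VecMem (hist K g ξ t) (fun ω (p : Fin t × S.IZ) => Z K g ξ p.1 ω p.2) :=
    fun p => vecMem_hist_Z K g ξ p.1.2 p.2
  simpa only [← Ut_eq] using h.mulVec (K.mat t)

theorem vecMem_hist_filt (t : ℕ) : VecMem (hist K g ξ t) (filt K g ξ t) := by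
  induction t with
  | zero => exact VecMem.zero
  | succ t ih =>
    have hx := (ih.mono (hist_mono K g ξ (Nat.le_succ t))).mulVec (lift S t)
    have hu := (vecMem_hist_Ut K g ξ t).mono (hist_mono K g ξ (Nat.le_succ t))
    have hz := vecMem_hist_Z K g ξ (Nat.lt_succ_self t)
    exact (((hx.mulVec _).add (hu.mulVec _)).add
      ((((hz.sub (hx.mulVec _)).sub (hu.mulVec _)).mulVec _).mulVec _)).mulVec _

theorem vecMem_hist_filtXYM (t : ℕ) : VecMem (hist K g ξ t) (filtXYM K g ξ t) :=
  (vecMem_hist_filt K g ξ t).mulVec (lift S t)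

theorem vecMem_space_processes {t : ℕ} (ht : t ≤ S.T) :
    VecMem (ξ.space t) (X K g ξ t) ∧ VecMem (ξ.space t) (M K g ξ t) ∧
      hist K g ξ t ≤ ξ.space t := by
  induction t with
  | zero =>
    refine ⟨ξ.vecMem_X0, VecMem.zero, Submodule.span_le.2 ?_⟩
    rintro f ⟨s, hs, -⟩
    exact absurd hs (Nat.not_lt_zero s)
  | succ t ih =>
    obtain ⟨hX, hM, hH⟩ := ih (Nat.le_of_succ_le ht)
    have hY : VecMem (ξ.space t) (Y K g ξ t) := (hX.mulVec _).add (ξ.vecMem_Ws ht)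
    have hU : VecMem (ξ.space t) (U K g ξ t) :=
      (((vecMem_hist_Ut K g ξ t).mono hH).add (hY.mulVec _)).add (hM.mulVec _)
    have hZ : VecMem (ξ.space t) (Z K g ξ t) :=
      ((hM.mulVec _).add (hY.mulVec _)).add (hU.mulVec _)
    have hle := ξ.space_mono (Nat.le_succ t)
    refine ⟨?_, ?_, Submodule.span_le.2 ?_⟩
    · exact (((hX.mulVec _).add (hU.mulVec _)).mono hle).add (ξ.vecMem_W0 ht)
    · exact (((hM.mulVec _).add (hY.mulVec _)).add (hU.mulVec _)).mono hle
    · rintro f ⟨s, hs, a, rfl⟩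
      rcases Nat.lt_succ_iff_lt_or_eq.1 hs with hs | rfl
      · exact hle (hH (vecMem_hist_Z K g ξ hs a))
      · exact hle (hZ a)

theorem hist_le_space {t : ℕ} (ht : t ≤ S.T) : hist K g ξ t ≤ ξ.space t :=
  (vecMem_space_processes K g ξ ht).2.2

theorem vecMem_space_XYM {t : ℕ} (ht : t < S.T) : VecMem (ξ.space t) (XYM K g ξ t) := by
  obtain ⟨hX, hM, -⟩ := vecMem_space_processes K g ξ ht.le
  exact hX.sumElim (((hX.mulVec _).add (ξ.vecMem_Ws ht)).sumElim hM)

theorem vecMem_space_err {t : ℕ} (ht : t < S.T) : VecMem (ξ.space t) (err K g ξ t) :=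
  (vecMem_space_XYM K g ξ ht).sub ((vecMem_hist_filtXYM K g ξ t).mono (hist_le_space K g ξ ht.le))
theorem Primitives.vecMem_noise {t : ℕ} (ht : t + 1 < S.T) :
    VecMem (ξ.space (t + 1)) (fun ω => Sum.elim (ξ.W0 t ω) (ξ.Ws (t + 1) ω)) :=
  (ξ.vecMem_W0 (Nat.lt_of_succ_lt ht)).sumElim (ξ.vecMem_Ws ht)

theorem Z_eq_err (t : ℕ) (ω : Ω) :
    Z K g ξ t ω = Ct g t *ᵥ err K g ξ t ω
      + (Ct g t *ᵥ filtXYM K g ξ t ω + Dt S t *ᵥ Ut K g ξ t ω) := by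
  rw [Z_eq, XYM_eq_filtXYM_add_err, Matrix.mulVec_add]
  abel

theorem vecMem_space_Z {t : ℕ} (ht : t < S.T) : VecMem (ξ.space t) (Z K g ξ t) := by
  have h := ((vecMem_space_XYM K g ξ ht).mulVec (Ct g t)).add
    (((vecMem_hist_Ut K g ξ t).mono (hist_le_space K g ξ ht.le)).mulVec (Dt S t))
  simpa only [← Z_eq] using h

/-- The shared memory at time `t` as one random vector. -/
def sharedMem (t : ℕ) (ω : Ω) (p : Fin t × S.IZ) : ℝ := Z K g ξ p.1 ω p.2

theorem common_le_comap_sharedMem (t : ℕ) :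
    common K g ξ t ≤ MeasurableSpace.comap (sharedMem K g ξ t) inferInstance := by
  have hZ : ∀ s < t, Measurable[MeasurableSpace.comap (sharedMem K g ξ t) inferInstance]
      (Z K g ξ s) := by
    intro s hs
    have h : Measurable fun (v : Fin t × S.IZ → ℝ) (a : S.IZ) => v (⟨s, hs⟩, a) := by fun_prop
    exact h.comp (comap_measurable _)
  refine iSup_le fun s => sup_le (hZ s s.2).comap_le ?_
  refine Measurable.comap_le ?_
  have h : Ut K g ξ s = fun ω => K.mat s *ᵥ fun p : Fin s × S.IZ => Z K g ξ p.1 ω p.2 :=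
    funext (Ut_eq K g ξ s)
  rw [h]
  have hm : Measurable fun v : Fin s × S.IZ → ℝ => K.mat s *ᵥ v := by
    unfold Matrix.mulVec dotProduct
    fun_prop
  refine hm.comp (@measurable_pi_lambda _ _ _ (_) _ _ fun p => ?_)
  exact (measurable_pi_apply p.2).comp (hZ p.1 (p.1.2.trans s.2))

theorem measurable_common_of_mem_hist {t : ℕ} {f : Ω → ℝ} (hf : f ∈ hist K g ξ t) :
    Measurable[common K g ξ t] f := by
  induction hf using Submodule.span_induction with
  | mem x hx =>
    obtain ⟨s, hs, a, rfl⟩ := hx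
    have hle : MeasurableSpace.comap (Z K g ξ s) inferInstance ≤ common K g ξ t :=
      le_sup_left.trans (le_iSup (fun s : Fin t =>
        MeasurableSpace.comap (Z K g ξ s) inferInstance ⊔
          MeasurableSpace.comap (Ut K g ξ s) inferInstance) ⟨s, hs⟩)
    exact (measurable_pi_apply a).comp ((comap_measurable (Z K g ξ s)).mono hle le_rfl)
  | zero => exact @measurable_const _ _ _ (common K g ξ t) 0
  | add x y _ _ hx hy => exact Measurable.add (m := common K g ξ t) hx hy
  | smul c x _ hx => exact Measurable.const_smul (m := common K g ξ t) hx c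

theorem vecMem_sharedMem {t : ℕ} (ht : t ≤ S.T) : VecMem (ξ.space t) (sharedMem K g ξ t) :=
  fun p => hist_le_space K g ξ ht (vecMem_hist_Z K g ξ p.1.2 p.2)

end Processes

end Model

theorem mom_mulVec_add_mulVec {Ω ι κ l : Type*} [MeasurableSpace Ω] {μ : Measure Ω} [Fintype ι]
    [Fintype κ] {V : Submodule ℝ (Ω → ℝ)} (hV : SqInt μ V) (A : Matrix l ι ℝ) (B : Matrix l κ ℝ)
    {f : Ω → ι → ℝ} {g : Ω → κ → ℝ} (hf : VecMem V f) (hg : VecMem V g) (h : mom μ f g = 0) :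
    mom μ (fun ω => A *ᵥ f ω + B *ᵥ g ω) (fun ω => A *ᵥ f ω + B *ᵥ g ω)
      = A * mom μ f f * Aᵀ + B * mom μ g g * Bᵀ := by
  have h' : mom μ g f = 0 := by rw [← mom_transpose, h, transpose_zero]
  have hA := hf.mulVec A
  have hB := hg.mulVec B
  rw [mom_add_left hV hA hB (hA.add hB), mom_add_right hV hA hA hB, mom_add_right hV hB hA hB,
    mom_mulVec_left hV A hf hA, mom_mulVec_left hV A hf hB, mom_mulVec_left hV B hg hA,
    mom_mulVec_left hV B hg hB, mom_mulVec_right hV A hf hf, mom_mulVec_right hV B hf hg,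
    mom_mulVec_right hV A hg hf, mom_mulVec_right hV B hg hg, h, h']
  simp [Matrix.mul_assoc]

namespace Model

section Estimation

variable {S : Model} {Ω : Type*} [MeasurableSpace Ω] {μ : Measure Ω} {ξ : S.Primitives Ω}

theorem Primitives.IsGaussianIndep.integral_of_mem_total (hξ : ξ.IsGaussianIndep μ) {f : Ω → ℝ}
    (hf : f ∈ ξ.total) : ∫ ω, f ω ∂μ = 0 := by
  obtain ⟨c, hc⟩ := (Submodule.mem_span_range_iff_exists_fun ℝ).1 hf
  have e : ∀ ω, f ω = ∑ k, c k * ξ.comp k ω := fun ω => by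
    simpa using (congrFun hc ω).symm
  simp only [e]
  rw [integral_finsetSum _ fun i _ => ((hξ.hasGaussianLaw_comp.eval i).integrable.const_mul _)]
  simp [integral_const_mul, hξ.integral_comp]

theorem Primitives.IsGaussianIndep.orth_noise (hξ : ξ.IsGaussianIndep μ) {t : ℕ}
    (ht : t + 1 < S.T) :
    Orth μ (fun ω => Sum.elim (ξ.W0 t ω) (ξ.Ws (t + 1) ω)) (ξ.space t) := by
  rintro (a | a)
  · exact hξ.orth_W0 (Nat.lt_of_succ_lt ht) a
  · exact hξ.orth_Ws (Nat.lt_succ_self t) ht a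

theorem Primitives.IsGaussianIndep.mom_noise (hξ : ξ.IsGaussianIndep μ) {t : ℕ}
    (ht : t + 1 < S.T) :
    mom μ (fun ω => Sum.elim (ξ.W0 t ω) (ξ.Ws (t + 1) ω))
      (fun ω => Sum.elim (ξ.W0 t ω) (ξ.Ws (t + 1) ω)) = fromBlocks S.covW0 0 0 (covWs S) := by
  have ht' := Nat.lt_of_succ_lt ht
  ext (a | a) (b | b)
  · exact congrFun (congrFun (hξ.mom_W0 ht') a) b
  · exact congrFun (congrFun (hξ.mom_W0_Ws ht' ht) a) b
  · have h := hξ.mom_W0_Ws ht' ht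
    rw [← mom_transpose, transpose_eq_zero] at h
    exact congrFun (congrFun h a) b
  · exact congrFun (congrFun (hξ.mom_Ws ht) a) b

variable (K : S.SharedGains) (g : S.LocalGains)

/-- The error dynamics annihilate the covariance of the error with the innovation. -/
theorem errMatrix_mul {P : Matrix S.IXYM S.IXYM ℝ} (hP : P.PosSemidef) (t : ℕ) :
    (At g t - At g t * gainOf g P t * Ct g t) * (P * (Ct g t)ᵀ) = 0 := by
  have h := gainOf_mul g hP t
  rw [Matrix.sub_mul, sub_eq_zero]
  conv_lhs => rw [← h]
  simp only [Matrix.mul_assoc]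

theorem errMatrix_mul_mul {P : Matrix S.IXYM S.IXYM ℝ} (hP : P.PosSemidef) (t : ℕ) :
    (At g t - At g t * gainOf g P t * Ct g t) * P * (At g t - At g t * gainOf g P t * Ct g t)ᵀ
      = At g t * P * (At g t)ᵀ - At g t * gainOf g P t * Ct g t * P * (At g t)ᵀ := by
  have h := errMatrix_mul g hP t
  set A' := At g t - At g t * gainOf g P t * Ct g t with hA'
  have e : A'ᵀ = (At g t)ᵀ - (Ct g t)ᵀ * (At g t * gainOf g P t)ᵀ := by
    rw [hA', transpose_sub, transpose_mul (At g t * gainOf g P t)]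
  rw [e, Matrix.mul_sub, ← Matrix.mul_assoc (A' * P), Matrix.mul_assoc A' P (Ct g t)ᵀ, h,
    Matrix.zero_mul, sub_zero, hA', Matrix.sub_mul, Matrix.sub_mul]

theorem mom_err_zero (hξ : ξ.IsGaussianIndep μ) (hT : 0 < S.T) :
    mom μ (err K g ξ 0) (err K g ξ 0) = Pt g 0 := by
  have h : err K g ξ 0 = fun ω => fromRows 1 (fromRows (S.C 0) 0) *ᵥ ξ.X0 ω
      + fromRows 0 (fromRows 1 0) *ᵥ ξ.Ws 0 ω := by
    funext ω
    rw [err, filtXYM_zero, sub_zero, XYM_zero]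
  rw [h, mom_mulVec_add_mulVec hξ.sqInt_total _ _ (ξ.vecMem_X0.mono (ξ.space_le_total 0))
    ((ξ.vecMem_Ws hT).mono (ξ.space_le_total 0)) (hξ.mom_X0_Ws hT), hξ.mom_X0, hξ.mom_Ws hT, Pt]
  simp only [transpose_fromRows, fromRows_mul, mul_fromCols, Matrix.one_mul, Matrix.zero_mul,
    Matrix.mul_zero, transpose_one, transpose_zero, Matrix.mul_one]
  ext (a | a | a) (b | b | b) <;> simp

/-- The error of the filter has second moments `P̃_t` and is orthogonal to the shared memory. -/
theorem mom_err_and_orth (hξ : ξ.IsGaussianIndep μ) {t : ℕ} (ht : t < S.T) :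
    mom μ (err K g ξ t) (err K g ξ t) = Pt g t ∧ Orth μ (err K g ξ t) (hist K g ξ t) := by
  have hV := hξ.sqInt_total
  induction t with
  | zero =>
    refine ⟨mom_err_zero K g hξ ht, Orth.of_span hV
      ((vecMem_space_err K g ξ ht).mono (ξ.space_le_total 0)) ?_ ?_⟩
    · rintro f ⟨s, hs, -⟩
      exact absurd hs (Nat.not_lt_zero s)
    · rintro a f ⟨s, hs, -⟩
      exact absurd hs (Nat.not_lt_zero s)
  | succ t ih =>
    have ht' := Nat.lt_of_succ_lt ht
    obtain ⟨ihP, ihO⟩ := ih ht'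
    have he := (vecMem_space_err K g ξ ht').mono (ξ.space_le_total t)
    have hP : (Pt g t).PosSemidef := ihP ▸ posSemidef_mom hV he
    have hw := (ξ.vecMem_noise ht).mono (ξ.space_le_total _)
    have hsucc : err K g ξ (t + 1) = _ := funext (err_succ K g ξ t)
    refine ⟨?_, Orth.of_span hV
      ((vecMem_space_err K g ξ ht).mono (ξ.space_le_total _)) ?_ ?_⟩
    · rw [hsucc, mom_mulVec_add_mulVec hV _ _ he hw
        ((hξ.orth_noise ht).mom_eq_zero' (vecMem_space_err K g ξ ht')), ihP, hξ.mom_noise ht,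
        errMatrix_mul_mul g hP, Pt, covNoise]
      abel
    · rintro f ⟨s, hs, a, rfl⟩
      exact ξ.space_le_total s (vecMem_space_Z K g ξ (hs.trans ht) a)
    · rintro a f ⟨s, hs, b, rfl⟩
      have hZs := vecMem_space_Z K g ξ (hs.trans ht)
      have hZ := hZs.mono (ξ.space_le_total s)
      suffices h : mom μ (err K g ξ (t + 1)) (Z K g ξ s) = 0 from congrFun (congrFun h a) b
      rw [hsucc, mom_add_left hV (he.mulVec _) (hw.mulVec _) hZ, mom_mulVec_left hV _ he hZ,
        mom_mulVec_left hV _ hw hZ, (hξ.orth_noise ht).mom_eq_zero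
          (hZs.mono (ξ.space_mono (Nat.le_of_lt_succ hs))), Matrix.mul_zero, add_zero]
      rcases Nat.lt_succ_iff_lt_or_eq.1 hs with hs | rfl
      · rw [ihO.mom_eq_zero (vecMem_hist_Z K g ξ hs), Matrix.mul_zero]
      · have hr := ((vecMem_hist_filtXYM K g ξ s).mulVec (Ct g s)).add
          ((vecMem_hist_Ut K g ξ s).mulVec (Dt S s))
        have hZeq : Z K g ξ s = _ := funext (Z_eq_err K g ξ s)
        rw [hZeq, mom_add_right hV he (he.mulVec _)
          (hr.mono ((hist_le_space K g ξ ht'.le).trans (ξ.space_le_total s))),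
          ihO.mom_eq_zero hr, add_zero, mom_mulVec_right hV _ he he, ihP, errMatrix_mul g hP]

theorem mom_err (hξ : ξ.IsGaussianIndep μ) {t : ℕ} (ht : t < S.T) :
    mom μ (err K g ξ t) (err K g ξ t) = Pt g t := (mom_err_and_orth K g hξ ht).1

theorem orth_err (hξ : ξ.IsGaussianIndep μ) {t : ℕ} (ht : t < S.T) :
    Orth μ (err K g ξ t) (hist K g ξ t) := (mom_err_and_orth K g hξ ht).2

theorem measurable_of_vecMem {ι : Type*} (hξ : ξ.IsGaussianIndep μ) {f : Ω → ι → ℝ}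
    (hf : VecMem ξ.total f) : Measurable f :=
  measurable_pi_lambda _ fun a => hξ.measurable_of_mem_total (hf a)

theorem common_le (hξ : ξ.IsGaussianIndep μ) {t : ℕ} (ht : t ≤ S.T) :
    common K g ξ t ≤ ‹MeasurableSpace Ω› :=
  (common_le_comap_sharedMem K g ξ t).trans
    (measurable_of_vecMem hξ ((vecMem_sharedMem K g ξ ht).mono (ξ.space_le_total t))).comap_le

theorem indep_err_common (hξ : ξ.IsGaussianIndep μ) {t : ℕ} (ht : t < S.T) :
    Indep (MeasurableSpace.comap (err K g ξ t) inferInstance) (common K g ξ t) μ := by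
  have h : IndepFun (err K g ξ t) (sharedMem K g ξ t) μ :=
    indepFun_of_mom_eq_zero hξ.hasGaussianLaw_comp hξ.integral_comp
      ((vecMem_space_err K g ξ ht).mono (ξ.space_le_total t))
      ((vecMem_sharedMem K g ξ ht.le).mono (ξ.space_le_total t))
      ((orth_err K g hξ ht).mom_eq_zero fun p => vecMem_hist_Z K g ξ p.1.2 p.2)
  exact indep_of_indep_of_le_right h (common_le_comap_sharedMem K g ξ t)

theorem integrable_of_mem_total (hξ : ξ.IsGaussianIndep μ) [IsProbabilityMeasure μ] {f : Ω → ℝ}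
    (hf : f ∈ ξ.total) : Integrable f μ :=
  (hξ.sqInt_total f hf).integrable one_le_two

theorem condExp_of_measurable_err [IsProbabilityMeasure μ] (hξ : ξ.IsGaussianIndep μ) {t : ℕ}
    (ht : t < S.T) {φ : (S.IXYM → ℝ) → ℝ} (hφ : Measurable φ) :
    μ[fun ω => φ (err K g ξ t ω) | common K g ξ t]
      =ᵐ[μ] fun _ => ∫ ω, φ (err K g ξ t ω) ∂μ := by
  have he := measurable_of_vecMem hξ ((vecMem_space_err K g ξ ht).mono (ξ.space_le_total t))
  refine condExp_indep_eq he.comap_le (common_le K g hξ ht.le) ?_ (indep_err_common K g hξ ht)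
  exact (hφ.comp (comap_measurable _)).stronglyMeasurable

/-- The conditional expectation of `vec(X_t, Y_t, M_t)` is the output of the filter. -/
theorem estXYM_eq_filtXYM [IsProbabilityMeasure μ] (hξ : ξ.IsGaussianIndep μ) {t : ℕ}
    (ht : t < S.T) : ∀ᵐ ω ∂μ, estXYM K g ξ μ t ω = filtXYM K g ξ t ω := by
  have h : ∀ a, (fun ω => estXYM K g ξ μ t ω a) =ᵐ[μ] fun ω => filtXYM K g ξ t ω a := by
    intro a
    have hf := vecMem_hist_filtXYM K g ξ t a
    have hft : (fun ω => filtXYM K g ξ t ω a) ∈ ξ.total :=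
      ξ.space_le_total t (hist_le_space K g ξ ht.le hf)
    have het : (fun ω => err K g ξ t ω a) ∈ ξ.total :=
      ξ.space_le_total t (vecMem_space_err K g ξ ht a)
    have e : (fun ω => XYM K g ξ t ω a)
        = (fun ω => filtXYM K g ξ t ω a) + fun ω => err K g ξ t ω a := by
      funext ω
      exact congrFun (XYM_eq_filtXYM_add_err K g ξ t ω) a
    have h1 := condExp_add (integrable_of_mem_total hξ hft) (integrable_of_mem_total hξ het)
      (common K g ξ t)
    have h2 := condExp_of_stronglyMeasurable (common_le K g hξ ht.le)
      (measurable_common_of_mem_hist K g ξ hf).stronglyMeasurable (integrable_of_mem_total hξ hft)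
    have h3 := condExp_of_measurable_err K g hξ ht (measurable_pi_apply a)
    have h4 : (fun ω => estXYM K g ξ μ t ω a) = μ[fun ω => XYM K g ξ t ω a | common K g ξ t] := rfl
    rw [h4, e]
    filter_upwards [h1, h3] with ω h1 h3
    rw [h1, Pi.add_apply, h2, h3, hξ.integral_of_mem_total het, add_zero]
  filter_upwards [ae_all_iff.2 h] with ω hω
  exact funext hω

theorem estXM_eq_filt [IsProbabilityMeasure μ] (hξ : ξ.IsGaussianIndep μ) {t : ℕ}
    (ht : t < S.T) : ∀ᵐ ω ∂μ, estXM K g ξ μ t ω = filt K g ξ t ω := by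
  filter_upwards [estXYM_eq_filtXYM K g hξ ht] with ω hω
  have h1 : estXM K g ξ μ t ω = proj S *ᵥ estXYM K g ξ μ t ω := by
    have e : estXYM K g ξ μ t ω = Sum.elim (fun a => estXYM K g ξ μ t ω (Sum.inl a))
        (Sum.elim (fun a => estXYM K g ξ μ t ω (Sum.inr (Sum.inl a)))
          fun a => estXYM K g ξ μ t ω (Sum.inr (Sum.inr a))) := by
      funext a
      rcases a with a | a | a <;> rfl
    rw [e]
    simp only [proj, fromRows_mulVec, fromCols_mulVec_sumElim, Matrix.one_mulVec,
      Matrix.zero_mulVec, add_zero, zero_add]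
    funext a
    rcases a with a | a <;> rfl
  rw [h1, hω, filtXYM, Matrix.mulVec_mulVec]
  have h2 : proj S * lift S t = 1 := by
    simp only [proj, lift, fromRows_mul, fromCols_mul_fromRows, Matrix.one_mul, Matrix.zero_mul,
      add_zero, zero_add]
    rw [fromRows_fromCols_eq_fromBlocks, fromBlocks_one]
  rw [h2, Matrix.one_mulVec]

theorem condExp_err_mul_err [IsProbabilityMeasure μ] (hξ : ξ.IsGaussianIndep μ) {t : ℕ}
    (ht : t < S.T) (a b : S.IXYM) :
    μ[fun ω => (XYM K g ξ t ω a - estXYM K g ξ μ t ω a) *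
        (XYM K g ξ t ω b - estXYM K g ξ μ t ω b) | common K g ξ t]
      =ᵐ[μ] fun _ => Pt g t a b := by
  have h1 : (fun ω => (XYM K g ξ t ω a - estXYM K g ξ μ t ω a) *
        (XYM K g ξ t ω b - estXYM K g ξ μ t ω b))
      =ᵐ[μ] fun ω => err K g ξ t ω a * err K g ξ t ω b := by
    filter_upwards [estXYM_eq_filtXYM K g hξ ht] with ω hω
    rw [hω]
    rfl
  have hm : Measurable fun v : S.IXYM → ℝ => v a * v b := by fun_prop
  refine (condExp_congr_ae h1).trans ((condExp_of_measurable_err K g hξ ht hm).trans ?_)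
  have h2 : ∫ ω, err K g ξ t ω a * err K g ξ t ω b ∂μ = Pt g t a b :=
    congrFun (congrFun (mom_err K g hξ ht) a) b
  rw [h2]

end Estimation

section Riccati

variable {S : Model} (g : S.LocalGains)

/-- `R + B̃_tᵀ V B̃_t`, where `V` is the value matrix of the next time. -/
def ctrlWeight (V : Matrix S.IXYM S.IXYM ℝ) (t : ℕ) : Matrix S.IU S.IU ℝ :=
  S.R + (Bt S t)ᵀ * V * Bt S t

/-- The minimizing gain when `V` is the value matrix of the next time. -/
def ctrlGain (V : Matrix S.IXYM S.IXYM ℝ) (t : ℕ) : Matrix S.IU S.IXYM ℝ :=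
  -((ctrlWeight V t)⁻¹ * Lam g V t)

theorem transpose_R : S.Rᵀ = S.R := by
  have h := S.R_posDef.isHermitian
  rwa [IsHermitian, conjTranspose_eq_transpose_of_trivial] at h

theorem posDef_ctrlWeight {V : Matrix S.IXYM S.IXYM ℝ} (hV : V.PosSemidef) (t : ℕ) :
    (ctrlWeight V t).PosDef := by
  have h := hV.conjTranspose_mul_mul_same (Bt S t)
  rw [conjTranspose_eq_transpose_of_trivial] at h
  exact S.R_posDef.add_posSemidef h

theorem ctrlWeight_mul_ctrlGain {V : Matrix S.IXYM S.IXYM ℝ} (hV : V.PosSemidef) (t : ℕ) :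
    ctrlWeight V t * ctrlGain g V t = -Lam g V t := by
  have hu : IsUnit (ctrlWeight V t).det :=
    (Matrix.isUnit_iff_isUnit_det _).1 (posDef_ctrlWeight hV t).isUnit
  rw [ctrlGain, Matrix.mul_neg, ← Matrix.mul_assoc, Matrix.mul_nonsing_inv _ hu, Matrix.one_mul]

/-- Completion of the square in the dynamic programming recursion. -/
theorem complete_square {l : Type*} [Fintype l] {V : Matrix S.IXYM S.IXYM ℝ}
    (hV : V.PosSemidef) (t : ℕ) (p : Matrix S.IXYM l ℝ) (q : Matrix S.IU l ℝ) :
    pᵀ * Qt g t * p + pᵀ * Nt g t * q + qᵀ * (Nt g t)ᵀ * p + qᵀ * S.R * q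
      + (At g t * p + Bt S t * q)ᵀ * V * (At g t * p + Bt S t * q)
    = pᵀ * riccatiStep g V t * p + (q - ctrlGain g V t * p)ᵀ * ctrlWeight V t *
        (q - ctrlGain g V t * p) := by
  have hVt : Vᵀ = V := by
    have h := hV.isHermitian
    rwa [IsHermitian, conjTranspose_eq_transpose_of_trivial] at h
  have hWt : (ctrlWeight V t)ᵀ = ctrlWeight V t := by
    have h := (posDef_ctrlWeight hV t).isHermitian
    rwa [IsHermitian, conjTranspose_eq_transpose_of_trivial] at h
  have h1 := ctrlWeight_mul_ctrlGain g hV t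
  have h2 : (ctrlGain g V t)ᵀ * ctrlWeight V t = -(Lam g V t)ᵀ := by
    rw [← transpose_neg, ← h1, transpose_mul, hWt]
  have h3 : riccatiStep g V t = (At g t)ᵀ * V * At g t + Qt g t
      - (ctrlGain g V t)ᵀ * ctrlWeight V t * ctrlGain g V t := by
    rw [h2, riccatiStep, ctrlGain, ctrlWeight, Matrix.neg_mul, Matrix.mul_neg, neg_neg,
      Matrix.mul_assoc (Lam g V t)ᵀ]
  have h4 : (q - ctrlGain g V t * p)ᵀ * ctrlWeight V t * (q - ctrlGain g V t * p)
      = qᵀ * ctrlWeight V t * q - qᵀ * (ctrlWeight V t * ctrlGain g V t) * p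
        - pᵀ * ((ctrlGain g V t)ᵀ * ctrlWeight V t) * q
        + pᵀ * ((ctrlGain g V t)ᵀ * ctrlWeight V t * ctrlGain g V t) * p := by
    simp only [transpose_sub, transpose_mul, Matrix.sub_mul, Matrix.mul_sub, Matrix.mul_assoc]
    abel
  rw [h4, h3, h1, h2, Lam, ctrlWeight]
  simp only [transpose_add, transpose_mul, transpose_transpose, hVt, Matrix.add_mul,
    Matrix.mul_add, Matrix.sub_mul, Matrix.mul_sub, Matrix.neg_mul, Matrix.mul_neg,
    Matrix.mul_assoc]
  abel

theorem posSemidef_riccatiStep {V : Matrix S.IXYM S.IXYM ℝ} (hV : V.PosSemidef) (t : ℕ) :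
    (riccatiStep g V t).PosSemidef := by
  have h := complete_square g hV t 1 (ctrlGain g V t)
  simp only [Matrix.mul_one, sub_self, Matrix.mul_zero, add_zero, transpose_one,
    Matrix.one_mul] at h
  have hQ : (fromBlocks S.Q 0 0 0 : Matrix S.IXYM S.IXYM ℝ).PosSemidef := by
    have e : (fromBlocks S.Q 0 0 0 : Matrix S.IXYM S.IXYM ℝ)
        = (fromCols 1 0 : Matrix S.IX S.IXYM ℝ)ᴴ * S.Q * (fromCols 1 0 : Matrix S.IX S.IXYM ℝ) := by
      rw [conjTranspose_eq_transpose_of_trivial, transpose_fromCols, fromRows_mul,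
        fromRows_mul_fromCols]
      simp
    rw [e]
    exact S.Q_posSemidef.conjTranspose_mul_mul_same _
  have e : riccatiStep g V t = fromBlocks S.Q 0 0 0
      + (g.loc t + ctrlGain g V t)ᴴ * S.R * (g.loc t + ctrlGain g V t)
      + (At g t + Bt S t * ctrlGain g V t)ᴴ * V * (At g t + Bt S t * ctrlGain g V t) := by
    rw [← h, Qt_eq, Nt_eq]
    simp only [conjTranspose_eq_transpose_of_trivial, transpose_add, transpose_mul,
      transpose_transpose, transpose_R, Matrix.add_mul, Matrix.mul_add, Matrix.mul_assoc]
    abel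
  rw [e]
  exact (hQ.add (S.R_posDef.posSemidef.conjTranspose_mul_mul_same _)).add
    (hV.conjTranspose_mul_mul_same _)

theorem posSemidef_St (t : ℕ) : (St g t).PosSemidef := by
  have h : ∀ k t, (valueToGo g k t).PosSemidef := by
    intro k
    induction k with
    | zero => exact fun t => PosSemidef.zero
    | succ k ih => exact fun t => posSemidef_riccatiStep g (ih (t + 1)) t
  exact h _ _

/-- The instantaneous cost as a function of `vec(X_t, Y_t, M_t)` and of `Ũ_t`. -/
def stageCost (t : ℕ) (x : S.IXYM → ℝ) (u : S.IU → ℝ) : ℝ :=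
  x ⬝ᵥ Qt g t *ᵥ x + x ⬝ᵥ Nt g t *ᵥ u + u ⬝ᵥ (Nt g t)ᵀ *ᵥ x + u ⬝ᵥ S.R *ᵥ u

theorem transpose_replicateCol_mul_mul {ι κ : Type*} [Fintype ι] [Fintype κ]
    (A : Matrix ι κ ℝ) (x : ι → ℝ) (y : κ → ℝ) :
    ((replicateCol Unit x)ᵀ * A * replicateCol Unit y) () () = x ⬝ᵥ A *ᵥ y := by
  rw [Matrix.mul_assoc]
  simp [Matrix.mul_apply, Matrix.mulVec, dotProduct]

theorem stageCost_add_value {V : Matrix S.IXYM S.IXYM ℝ} (hV : V.PosSemidef) (t : ℕ)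
    (x : S.IXYM → ℝ) (u : S.IU → ℝ) :
    stageCost g t x u + (At g t *ᵥ x + Bt S t *ᵥ u) ⬝ᵥ V *ᵥ (At g t *ᵥ x + Bt S t *ᵥ u)
      = x ⬝ᵥ riccatiStep g V t *ᵥ x + (u - ctrlGain g V t *ᵥ x) ⬝ᵥ
          ctrlWeight V t *ᵥ (u - ctrlGain g V t *ᵥ x) := by
  have h := complete_square g hV t (replicateCol Unit x) (replicateCol Unit u)
  have e1 : At g t * replicateCol Unit x + Bt S t * replicateCol Unit u
      = replicateCol Unit (At g t *ᵥ x + Bt S t *ᵥ u) := by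
    rw [replicateCol_add, replicateCol_mulVec, replicateCol_mulVec]
  have e2 : replicateCol Unit u - ctrlGain g V t * replicateCol Unit x
      = replicateCol Unit (u - ctrlGain g V t *ᵥ x) := by
    rw [← replicateCol_mulVec]
    rfl
  rw [e1, e2] at h
  have h' := congrFun (congrFun h ()) ()
  simp only [Matrix.add_apply, transpose_replicateCol_mul_mul] at h'
  exact h'

theorem stageCost_XYM {Ω : Type*} (K : S.SharedGains) (ξ : S.Primitives Ω) (t : ℕ) (ω : Ω) :
    X K g ξ t ω ⬝ᵥ S.Q *ᵥ X K g ξ t ω + U K g ξ t ω ⬝ᵥ S.R *ᵥ U K g ξ t ω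
      = stageCost g t (XYM K g ξ t ω) (Ut K g ξ t ω) := by
  have hX : X K g ξ t ω ⬝ᵥ S.Q *ᵥ X K g ξ t ω
      = XYM K g ξ t ω ⬝ᵥ (fromBlocks S.Q 0 0 0 : Matrix S.IXYM S.IXYM ℝ) *ᵥ XYM K g ξ t ω := by
    simp [XYM, fromBlocks_mulVec, sumElim_dotProduct_sumElim]
  rw [U_eq, hX, stageCost, Qt_eq, Nt_eq]
  generalize XYM K g ξ t ω = x
  generalize Ut K g ξ t ω = u
  simp only [← transpose_replicateCol_mul_mul, replicateCol_add, replicateCol_mulVec]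
  simp only [← Matrix.add_apply]
  refine congrFun (congrFun ?_ ()) ()
  simp only [transpose_add, transpose_mul, transpose_transpose, transpose_R, Matrix.add_mul,
    Matrix.mul_add, Matrix.mul_assoc]
  abel

end Riccati

section Cost

variable {S : Model} {Ω : Type*} {ξ : S.Primitives Ω} (K : S.SharedGains) (g : S.LocalGains)

theorem vecMem_total_Ut {t : ℕ} (ht : t ≤ S.T) : VecMem ξ.total (Ut K g ξ t) :=
  (vecMem_hist_Ut K g ξ t).mono ((hist_le_space K g ξ ht).trans (ξ.space_le_total t))

theorem vecMem_total_filtXYM {t : ℕ} (ht : t ≤ S.T) : VecMem ξ.total (filtXYM K g ξ t) :=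
  (vecMem_hist_filtXYM K g ξ t).mono ((hist_le_space K g ξ ht).trans (ξ.space_le_total t))

/-- The deviation of the coordinator's control from the optimal one. -/
def deviation (ξ : S.Primitives Ω) (t : ℕ) (ω : Ω) : S.IU → ℝ :=
  Ut K g ξ t ω - Kt g t *ᵥ filtXYM K g ξ t ω

theorem vecMem_total_deviation {t : ℕ} (ht : t ≤ S.T) : VecMem ξ.total (deviation K g ξ t) :=
  (vecMem_total_Ut K g ht).sub ((vecMem_total_filtXYM K g ht).mulVec _)

theorem totalCost_eq (ω : Ω) : totalCost K g ξ ω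
    = ∑ t ∈ Finset.range S.T, stageCost g t (XYM K g ξ t ω) (Ut K g ξ t ω) :=
  Finset.sum_congr rfl fun t _ => stageCost_XYM g K ξ t ω

/-- The coefficients of the estimate of `vec(X_t, M_t)` as a linear function of the shared memory,
under the control `Ũ_t = L̃_t S̆_t`. -/
def filtCoeff : ℕ → ℕ → Matrix S.IXM S.IZ ℝ
  | 0, _ => 0
  | t + 1, s =>
    proj S * (At g t * lift S t + Bt S t * Lt g t
        - At g t * gainOf g (Pt g t) t * (Ct g t * lift S t + Dt S t * Lt g t)) * filtCoeff t s
      + if s = t then proj S * At g t * gainOf g (Pt g t) t else 0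

/-- The best gains on the shared memory for the local gains `g`. -/
def optShared : S.SharedGains := fun t i =>
  Matrix.of fun a p => (Lt g t * filtCoeff g t p.1) ⟨i, a⟩ p.2

theorem Ut_optShared (ξ : S.Primitives Ω) (t : ℕ) (ω : Ω) :
    Ut (optShared g) g ξ t ω = Lt g t *ᵥ
      ∑ s ∈ Finset.range t, filtCoeff g t s *ᵥ Z (optShared g) g ξ s ω := by
  rw [Ut_eq, Matrix.mulVec_sum]
  simp only [Matrix.mulVec_mulVec]
  rw [Finset.sum_range fun s => (Lt g t * filtCoeff g t s) *ᵥ Z (optShared g) g ξ s ω]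
  funext a
  simp only [Matrix.mulVec, dotProduct, Finset.sum_apply, Fintype.sum_prod_type]
  rfl

theorem filt_optShared (ξ : S.Primitives Ω) (t : ℕ) (ω : Ω) :
    filt (optShared g) g ξ t ω
      = ∑ s ∈ Finset.range t, filtCoeff g t s *ᵥ Z (optShared g) g ξ s ω := by
  induction t with
  | zero => rfl
  | succ t ih =>
    have hu := Ut_optShared g ξ t ω
    rw [← ih] at hu
    rw [filt, hu, Finset.sum_range_succ]
    have h0 : ∀ t s, t ≤ s → filtCoeff g t s = 0 := by
      intro t
      induction t with
      | zero => exact fun s _ => rfl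
      | succ t iht =>
        intro s hs
        rw [filtCoeff, iht s (Nat.le_of_succ_le hs), if_neg (Nat.lt_of_succ_le hs).ne']
        simp
    have h1 : filtCoeff g (t + 1) t = proj S * At g t * gainOf g (Pt g t) t := by
      rw [filtCoeff, h0 t t le_rfl, if_pos rfl, Matrix.mul_zero, zero_add]
    have h2 : ∀ s ∈ Finset.range t, filtCoeff g (t + 1) s *ᵥ Z (optShared g) g ξ s ω
        = (proj S * (At g t * lift S t + Bt S t * Lt g t
          - At g t * gainOf g (Pt g t) t * (Ct g t * lift S t + Dt S t * Lt g t))) *ᵥ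
            filtCoeff g t s *ᵥ Z (optShared g) g ξ s ω := by
      intro s hs
      rw [filtCoeff, if_neg (Finset.mem_range.1 hs).ne, add_zero, Matrix.mulVec_mulVec]
    rw [Finset.sum_congr rfl h2, ← Matrix.mulVec_sum, ← ih, h1, update]
    simp only [Matrix.mulVec_add, Matrix.mulVec_sub, Matrix.mulVec_mulVec, Matrix.add_mulVec,
      Matrix.sub_mulVec, Matrix.mul_add, Matrix.mul_sub, Matrix.mul_assoc]
    abel

variable [MeasurableSpace Ω] {μ : Measure Ω}

theorem integrable_stageCost (hξ : ξ.IsGaussianIndep μ) (t : ℕ) {f : Ω → S.IXYM → ℝ}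
    {u : Ω → S.IU → ℝ} (hf : VecMem ξ.total f) (hu : VecMem ξ.total u) :
    Integrable (fun ω => stageCost g t (f ω) (u ω)) μ := by
  have hV := hξ.sqInt_total
  exact (((integrable_dotProduct_mulVec hV _ hf hf).add
    (integrable_dotProduct_mulVec hV _ hf hu)).add (integrable_dotProduct_mulVec hV _ hu hf)).add
    (integrable_dotProduct_mulVec hV _ hu hu)

theorem integral_stageCost (hξ : ξ.IsGaussianIndep μ) (t : ℕ) {f : Ω → S.IXYM → ℝ}
    {u : Ω → S.IU → ℝ} (hf : VecMem ξ.total f) (hu : VecMem ξ.total u) :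
    ∫ ω, stageCost g t (f ω) (u ω) ∂μ = (Qt g t * mom μ f f).trace + (Nt g t * mom μ u f).trace
      + ((Nt g t)ᵀ * mom μ f u).trace + (S.R * mom μ u u).trace := by
  have hV := hξ.sqInt_total
  have i1 := integrable_dotProduct_mulVec hV (Qt g t) hf hf
  have i2 := integrable_dotProduct_mulVec hV (Nt g t) hf hu
  have i3 := integrable_dotProduct_mulVec hV (Nt g t)ᵀ hu hf
  have i4 := integrable_dotProduct_mulVec hV S.R hu hu
  refine (integral_add ((i1.add i2).add i3) i4).trans ?_
  rw [integral_add' (i1.add i2) i3, integral_add' i1 i2,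
    integral_dotProduct_mulVec hV _ hf hf, integral_dotProduct_mulVec hV _ hf hu,
    integral_dotProduct_mulVec hV _ hu hf, integral_dotProduct_mulVec hV _ hu hu]

theorem integral_stageCost_XYM (hξ : ξ.IsGaussianIndep μ) {t : ℕ} (ht : t < S.T) :
    ∫ ω, stageCost g t (XYM K g ξ t ω) (Ut K g ξ t ω) ∂μ
      = ∫ ω, stageCost g t (filtXYM K g ξ t ω) (Ut K g ξ t ω) ∂μ + (Pt g t * Qt g t).trace := by
  have hV := hξ.sqInt_total
  have hu := vecMem_total_Ut (ξ := ξ) K g ht.le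
  have hx := vecMem_total_filtXYM (ξ := ξ) K g ht.le
  have he := (vecMem_space_err K g ξ ht).mono (ξ.space_le_total t)
  have hO := orth_err K g hξ ht
  have h1 := hO.mom_eq_zero (vecMem_hist_filtXYM K g ξ t)
  have h1' := hO.mom_eq_zero' (vecMem_hist_filtXYM K g ξ t)
  have h2 := hO.mom_eq_zero (vecMem_hist_Ut K g ξ t)
  have h2' := hO.mom_eq_zero' (vecMem_hist_Ut K g ξ t)
  have e : XYM K g ξ t = fun ω => filtXYM K g ξ t ω + err K g ξ t ω :=
    funext (XYM_eq_filtXYM_add_err K g ξ t)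
  rw [integral_stageCost g hξ t ((vecMem_space_XYM K g ξ ht).mono (ξ.space_le_total t)) hu,
    integral_stageCost g hξ t hx hu, e, mom_add_left hV hx he (hx.add he),
    mom_add_right hV hx hx he, mom_add_right hV he hx he, mom_add_right hV hu hx he,
    mom_add_left hV hx he hu, h1, h1', h2, h2', mom_err K g hξ ht, add_zero, add_zero, add_zero,
    zero_add, Matrix.mul_add, trace_add, trace_mul_comm (Qt g t) (Pt g t)]
  ring

theorem integral_value_filtXYM (hξ : ξ.IsGaussianIndep μ) {t : ℕ} (ht : t < S.T)
    (V : Matrix S.IXYM S.IXYM ℝ) :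
    ∫ ω, filtXYM K g ξ (t + 1) ω ⬝ᵥ V *ᵥ filtXYM K g ξ (t + 1) ω ∂μ
      = ∫ ω, (At g t *ᵥ filtXYM K g ξ t ω + Bt S t *ᵥ Ut K g ξ t ω) ⬝ᵥ
          V *ᵥ (At g t *ᵥ filtXYM K g ξ t ω + Bt S t *ᵥ Ut K g ξ t ω) ∂μ
        + ((covNoise S t + At g t * Pt g t * (At g t)ᵀ - Pt g (t + 1)) * V).trace := by
  have hV := hξ.sqInt_total
  have hu := vecMem_hist_Ut K g ξ t
  have hx := vecMem_hist_filtXYM K g ξ t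
  have hle := (hist_le_space K g ξ ht.le).trans (ξ.space_le_total t)
  have he := (vecMem_space_err K g ξ ht).mono (ξ.space_le_total t)
  have hP : (Pt g t).PosSemidef := mom_err K g hξ ht ▸ posSemidef_mom hV he
  have hy := (hx.mulVec (At g t)).add (hu.mulVec (Bt S t))
  have hO := (orth_err K g hξ ht).mom_eq_zero' hy
  have hy' := hy.mono hle
  have e : filtXYM K g ξ (t + 1) = fun ω =>
      (1 : Matrix S.IXYM S.IXYM ℝ) *ᵥ (At g t *ᵥ filtXYM K g ξ t ω + Bt S t *ᵥ Ut K g ξ t ω)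
        + (At g t * gainOf g (Pt g t) t * Ct g t) *ᵥ err K g ξ t ω := by
    funext ω
    rw [filtXYM_succ, Matrix.one_mulVec]
  have hΔ : (At g t * gainOf g (Pt g t) t * Ct g t) * Pt g t *
      (At g t * gainOf g (Pt g t) t * Ct g t)ᵀ
        = covNoise S t + At g t * Pt g t * (At g t)ᵀ - Pt g (t + 1) := by
    have h := congrArg Matrix.transpose (gainOf_mul g hP t)
    have hPt : (Pt g t)ᵀ = Pt g t := by
      have h := hP.isHermitian
      rwa [IsHermitian, conjTranspose_eq_transpose_of_trivial] at h
    simp only [transpose_mul, transpose_transpose, hPt, Matrix.mul_assoc] at h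
    rw [Pt]
    simp only [transpose_mul, Matrix.mul_assoc] at h ⊢
    rw [show ∀ N : Matrix S.IXYM S.IXYM ℝ, Ct g t * (Pt g t * ((Ct g t)ᵀ *
        ((gainOf g (Pt g t) t)ᵀ * N))) = Ct g t * (Pt g t * N) from fun N => by
      have h' := congrArg (fun L => L * N) h
      simpa only [Matrix.mul_assoc] using h']
    abel
  rw [integral_dotProduct_mulVec hV V (vecMem_total_filtXYM K g ht)
      (vecMem_total_filtXYM K g ht), integral_dotProduct_mulVec hV V hy' hy', e,
    mom_mulVec_add_mulVec hV _ _ hy' he hO, mom_err K g hξ ht, hΔ, Matrix.one_mul, transpose_one,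
    Matrix.mul_one, Matrix.mul_add, trace_add, trace_mul_comm V (_ - _)]

/-- The expected excess of the cost-to-go at time `t` over the optimal one. -/
def excess (ξ : S.Primitives Ω) (μ : Measure Ω) (t : ℕ) : ℝ :=
  ∫ ω, deviation K g ξ t ω ⬝ᵥ ctrlWeight (St g (t + 1)) t *ᵥ deviation K g ξ t ω ∂μ

theorem dynamic_programming_step (hξ : ξ.IsGaussianIndep μ) {t : ℕ} (ht : t < S.T) :
    ∫ ω, stageCost g t (XYM K g ξ t ω) (Ut K g ξ t ω) ∂μ
      + ∫ ω, filtXYM K g ξ (t + 1) ω ⬝ᵥ St g (t + 1) *ᵥ filtXYM K g ξ (t + 1) ω ∂μ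
    = ∫ ω, filtXYM K g ξ t ω ⬝ᵥ St g t *ᵥ filtXYM K g ξ t ω ∂μ + excess K g ξ μ t
      + (Pt g t * Qt g t + (covNoise S t + At g t * Pt g t * (At g t)ᵀ - Pt g (t + 1)) *
          St g (t + 1)).trace := by
  have hV := hξ.sqInt_total
  have hu := vecMem_total_Ut (ξ := ξ) K g ht.le
  have hx := vecMem_total_filtXYM (ξ := ξ) K g ht.le
  have hv := vecMem_total_deviation (ξ := ξ) K g ht.le
  have hy := (hx.mulVec (At g t)).add (hu.mulVec (Bt S t))
  have h : ∫ ω, stageCost g t (filtXYM K g ξ t ω) (Ut K g ξ t ω) ∂μ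
      + ∫ ω, (At g t *ᵥ filtXYM K g ξ t ω + Bt S t *ᵥ Ut K g ξ t ω) ⬝ᵥ
          St g (t + 1) *ᵥ (At g t *ᵥ filtXYM K g ξ t ω + Bt S t *ᵥ Ut K g ξ t ω) ∂μ
      = ∫ ω, filtXYM K g ξ t ω ⬝ᵥ St g t *ᵥ filtXYM K g ξ t ω ∂μ + excess K g ξ μ t := by
    rw [excess, ← integral_add (integrable_stageCost g hξ t hx hu)
      (integrable_dotProduct_mulVec hV _ hy hy), ← integral_add
      (integrable_dotProduct_mulVec hV _ hx hx) (integrable_dotProduct_mulVec hV _ hv hv)]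
    refine integral_congr_ae (Filter.Eventually.of_forall fun ω => ?_)
    have hs := stageCost_add_value g (posSemidef_St g (t + 1)) t (filtXYM K g ξ t ω)
      (Ut K g ξ t ω)
    rw [← (St_spec g).2 t ht] at hs
    exact hs
  rw [integral_stageCost_XYM K g hξ ht, integral_value_filtXYM K g hξ ht, trace_add]
  linarith

theorem integrable_stageCost_XYM (hξ : ξ.IsGaussianIndep μ) {t : ℕ} (ht : t < S.T) :
    Integrable (fun ω => stageCost g t (XYM K g ξ t ω) (Ut K g ξ t ω)) μ :=
  integrable_stageCost g hξ t ((vecMem_space_XYM K g ξ ht).mono (ξ.space_le_total t))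
    (vecMem_total_Ut K g ht.le)

theorem integrable_totalCost (hξ : ξ.IsGaussianIndep μ) : Integrable (totalCost K g ξ) μ := by
  rw [show totalCost K g ξ = _ from funext (totalCost_eq K g)]
  exact integrable_finsetSum _ fun t ht =>
    integrable_stageCost_XYM K g hξ (Finset.mem_range.1 ht)

theorem cost_eq_perf_add_excess (hξ : ξ.IsGaussianIndep μ) :
    cost K g ξ μ = perf g + ∑ t ∈ Finset.range S.T, excess K g ξ μ t := by
  have h : ∀ n ≤ S.T, ∑ t ∈ Finset.range n, ∫ ω, stageCost g t (XYM K g ξ t ω) (Ut K g ξ t ω) ∂μ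
      + ∫ ω, filtXYM K g ξ n ω ⬝ᵥ St g n *ᵥ filtXYM K g ξ n ω ∂μ
      = ∑ t ∈ Finset.range n, (Pt g t * Qt g t
          + (covNoise S t + At g t * Pt g t * (At g t)ᵀ - Pt g (t + 1)) * St g (t + 1)).trace
        + ∑ t ∈ Finset.range n, excess K g ξ μ t := by
    intro n hn
    induction n with
    | zero => simp [filtXYM_zero]
    | succ n ih =>
      have h1 := ih (Nat.le_of_succ_le hn)
      have h2 := dynamic_programming_step K g hξ (Nat.lt_of_succ_le hn)
      rw [Finset.sum_range_succ, Finset.sum_range_succ, Finset.sum_range_succ]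
      linarith
  have h1 := h S.T le_rfl
  rw [(St_spec g).1] at h1
  simp only [Matrix.zero_mulVec, dotProduct_zero, integral_zero, add_zero] at h1
  rw [cost, perf, ← h1]
  simp only [totalCost_eq]
  exact integral_finsetSum _ fun t ht => integrable_stageCost_XYM K g hξ (Finset.mem_range.1 ht)

theorem excess_nonneg (t : ℕ) : 0 ≤ excess K g ξ μ t := by
  refine integral_nonneg fun ω => ?_
  have h := (posDef_ctrlWeight (posSemidef_St g (t + 1)) t).posSemidef.dotProduct_mulVec_nonneg
    (deviation K g ξ t ω)
  simpa using h

theorem excess_eq_zero_iff (hξ : ξ.IsGaussianIndep μ) {t : ℕ} (ht : t < S.T) :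
    excess K g ξ μ t = 0
      ↔ ∀ᵐ ω ∂μ, Ut K g ξ t ω = Lt g t *ᵥ filt K g ξ t ω := by
  have hW := posDef_ctrlWeight (posSemidef_St g (t + 1)) t
  have hv := vecMem_total_deviation (ξ := ξ) K g ht.le
  rw [excess, integral_eq_zero_iff_of_nonneg
    (fun ω => by simpa using hW.posSemidef.dotProduct_mulVec_nonneg (deviation K g ξ t ω))
    (integrable_dotProduct_mulVec hξ.sqInt_total _ hv hv)]
  refine Filter.eventually_congr (Filter.Eventually.of_forall fun ω => ?_)
  have e : deviation K g ξ t ω = Ut K g ξ t ω - Lt g t *ᵥ filt K g ξ t ω := by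
    rw [deviation, filtXYM, Lt, Matrix.mulVec_mulVec]
  rw [← sub_eq_zero (a := Ut K g ξ t ω), ← e]
  constructor
  · intro h
    by_contra hne
    have hpos := hW.dotProduct_mulVec_pos hne
    simp only [star_trivial] at hpos
    exact hpos.ne' h
  · intro h
    simp [h]

theorem perf_le_cost (hξ : ξ.IsGaussianIndep μ) : perf g ≤ cost K g ξ μ := by
  rw [cost_eq_perf_add_excess K g hξ]
  exact le_add_of_nonneg_right (Finset.sum_nonneg fun t _ => excess_nonneg K g t)

theorem cost_eq_perf_iff (hξ : ξ.IsGaussianIndep μ) :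
    cost K g ξ μ = perf g
      ↔ ∀ t < S.T, ∀ᵐ ω ∂μ, Ut K g ξ t ω = Lt g t *ᵥ filt K g ξ t ω := by
  rw [cost_eq_perf_add_excess K g hξ, add_eq_left,
    Finset.sum_eq_zero_iff_of_nonneg fun t _ => excess_nonneg K g t]
  exact forall_congr' fun t => by
    rw [Finset.mem_range]
    exact forall_congr' fun ht => excess_eq_zero_iff K g hξ ht

theorem cost_optShared (hξ : ξ.IsGaussianIndep μ) : cost (optShared g) g ξ μ = perf g :=
  (cost_eq_perf_iff (optShared g) g hξ).2 fun t _ => Filter.Eventually.of_forall fun ω => by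
    rw [Ut_optShared, filt_optShared]

theorem isBestShared_iff (hξ : ξ.IsGaussianIndep μ) :
    IsBestShared K g ξ μ ↔ cost K g ξ μ = perf g := by
  constructor
  · intro h
    exact le_antisymm (cost_optShared g hξ ▸ h (optShared g)) (perf_le_cost K g hξ)
  · intro h K'
    exact h ▸ perf_le_cost K' g hξ

theorem isBestLinear_iff (hξ : ξ.IsGaussianIndep μ) :
    IsBestLinear K g ξ μ
      ↔ (∀ g' : S.LocalGains, perf g ≤ perf g') ∧ cost K g ξ μ = perf g := by
  constructor
  · intro h
    have hc := (isBestShared_iff K g hξ).1 fun K' => h K' g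
    refine ⟨fun g' => ?_, hc⟩
    rw [← hc, ← cost_optShared g' hξ]
    exact h _ _
  · rintro ⟨hg, hc⟩ K' g'
    exact hc ▸ (hg g').trans (perf_le_cost K' g' hξ)

theorem estXM_zero (hξ : ξ.IsGaussianIndep μ) [IsProbabilityMeasure μ] :
    ∀ᵐ ω ∂μ, estXM K g ξ μ 0 ω = 0 := by
  obtain ⟨hX, hM, -⟩ := vecMem_space_processes K g ξ (Nat.zero_le S.T)
  have h0 : common K g ξ 0 = ⊥ := iSup_of_empty _
  refine Filter.Eventually.of_forall fun ω => funext fun a => ?_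
  rw [estXM, h0, condExp_bot]
  exact hξ.integral_of_mem_total (ξ.space_le_total 0 (hX.sumElim hM a))

theorem cost_eq_perf_iff_control [IsProbabilityMeasure μ] (hξ : ξ.IsGaussianIndep μ) :
    cost K g ξ μ = perf g ↔ ∀ t < S.T, ∀ᵐ ω ∂μ,
      U K g ξ t ω = Lt g t *ᵥ estXM K g ξ μ t ω + g.G t *ᵥ Y K g ξ t ω + g.H t *ᵥ M K g ξ t ω := by
  rw [cost_eq_perf_iff K g hξ]
  refine forall_congr' fun t => forall_congr' fun ht => ?_
  refine Filter.eventually_congr ?_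
  filter_upwards [estXM_eq_filt K g hξ ht] with ω hω
  rw [U, hω, add_left_inj, add_left_inj]

end Cost

end Model

end PHS

end

theorem theorem3 (S : PHS.Model) {Ω : Type*} [MeasurableSpace Ω] (μ : Measure Ω)
    [IsProbabilityMeasure μ] (ξ : S.Primitives Ω) (hξ : ξ.IsGaussianIndep μ) :
    -- the estimates and their evolution, under every linear strategy
    (∀ (K : S.SharedGains) (g : S.LocalGains),
      Integrable (PHS.Model.totalCost K g ξ) μ ∧
      (∀ t < S.T, ∀ a, Integrable (fun ω => PHS.Model.XYM K g ξ t ω a) μ) ∧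
      (∀ t < S.T, ∀ᵐ ω ∂μ,
        PHS.Model.estXYM K g ξ μ t ω
          = PHS.Model.lift S t *ᵥ PHS.Model.estXM K g ξ μ t ω) ∧
      (∀ᵐ ω ∂μ, PHS.Model.estXM K g ξ μ 0 ω = 0) ∧
      (∀ t, t + 1 < S.T → ∀ᵐ ω ∂μ,
        PHS.Model.estXM K g ξ μ (t + 1) ω
          = PHS.Model.update g t (PHS.Model.estXM K g ξ μ t ω)
              (PHS.Model.Ut K g ξ t ω) (PHS.Model.Z K g ξ t ω)) ∧
      (∀ t < S.T, ∀ a b,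
        μ[fun ω => (PHS.Model.XYM K g ξ t ω a - PHS.Model.estXYM K g ξ μ t ω a) *
              (PHS.Model.XYM K g ξ t ω b - PHS.Model.estXYM K g ξ μ t ω b)
            | PHS.Model.common K g ξ t] =ᵐ[μ] fun _ => PHS.Model.Pt g t a b)) ∧
    -- for arbitrary fixed local gains: best shared-memory gains exist, they are exactly those
    -- that generate the control `L̃ S̆ + G Y + H M`, and their performance is `perf`
    (∀ g : S.LocalGains,
      (∃ K : S.SharedGains, PHS.Model.IsBestShared K g ξ μ) ∧
      ∀ K : S.SharedGains,
        (PHS.Model.IsBestShared K g ξ μ ↔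
          ∀ t < S.T, ∀ᵐ ω ∂μ,
            PHS.Model.U K g ξ t ω
              = PHS.Model.Lt g t *ᵥ PHS.Model.estXM K g ξ μ t ω
                + g.G t *ᵥ PHS.Model.Y K g ξ t ω + g.H t *ᵥ PHS.Model.M K g ξ t ω) ∧
        (PHS.Model.IsBestShared K g ξ μ → PHS.Model.cost K g ξ μ = PHS.Model.perf g)) ∧
    -- the best linear strategies
    (∀ (K : S.SharedGains) (g : S.LocalGains),
      PHS.Model.IsBestLinear K g ξ μ ↔
        (∀ g' : S.LocalGains, PHS.Model.perf g ≤ PHS.Model.perf g') ∧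
        ∀ t < S.T, ∀ᵐ ω ∂μ,
          PHS.Model.U K g ξ t ω
            = PHS.Model.Lt g t *ᵥ PHS.Model.estXM K g ξ μ t ω
              + g.G t *ᵥ PHS.Model.Y K g ξ t ω + g.H t *ᵥ PHS.Model.M K g ξ t ω) := by
  refine ⟨fun K g => ⟨PHS.Model.integrable_totalCost K g hξ, fun t ht a => ?_, fun t ht => ?_, ?_,
    fun t ht => ?_, fun t ht => PHS.Model.condExp_err_mul_err K g hξ ht⟩,
    fun g => ⟨?_, fun K => ⟨?_, ?_⟩⟩,
    fun K g => ?_⟩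
  · exact PHS.Model.integrable_of_mem_total hξ
      (ξ.space_le_total t (PHS.Model.vecMem_space_XYM K g ξ ht a))
  · filter_upwards [PHS.Model.estXYM_eq_filtXYM K g hξ ht, PHS.Model.estXM_eq_filt K g hξ ht]
      with ω h1 h2
    rw [h1, h2, PHS.Model.filtXYM]
  · exact PHS.Model.estXM_zero K g hξ
  · filter_upwards [PHS.Model.estXM_eq_filt K g hξ ht,
      PHS.Model.estXM_eq_filt K g hξ (Nat.lt_of_succ_lt ht)] with ω h1 h2
    rw [h1, h2, PHS.Model.filt]
  · exact ⟨PHS.Model.optShared g,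
      (PHS.Model.isBestShared_iff _ g hξ).2 (PHS.Model.cost_optShared g hξ)⟩
  · rw [PHS.Model.isBestShared_iff K g hξ, PHS.Model.cost_eq_perf_iff_control K g hξ]
  · exact (PHS.Model.isBestShared_iff K g hξ).1
  · rw [PHS.Model.isBestLinear_iff K g hξ, PHS.Model.cost_eq_perf_iff_control K g hξ]
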